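/- Fix a finite set $AP$ of atomic propositions and let $\Sigma = 2^{AP}$. HyperLTL formulas over $AP$ have the form $\exists\pi.\varphi$, $\forall\pi.\varphi$ or $\psi$ with $\psi ::= a_\pi \mid \neg\psi \mid \psi\vee\psi \mid \bigcirc\psi \mid \psi\,\mathcal U\,\psi$, with the usual semantics over sets $T'\subseteq\Sigma^\omega$ of traces. A formula $\varphi=\forall\pi_1\dots\forall\pi_{k_T}.\psi$ is \emph{universally safe} if $\psi$ is quantifier-free and a safety LTL formula: every $\rho\in(\Sigma^{k_T})^\omega$ violating $\psi$ has a finite prefix all of whose infinite extensions violate $\psi$. A set $T\subseteq\Sigma^*$ is a \emph{bad prefix} of $\varphi$ if every $T'\subseteq\Sigma^\omega$ such that each $t\in T$ is a prefix of some $t'\in T'$ violates $\varphi$. A word $w\in(\Sigma^{k})^*$ is a \emph{representation} of the set $\mathrm{unzip}(w)\subseteq\Sigma^*$ of its $k$ component words. For a DFA $\mathcal A$ let $|\mathcal A|$ be its number of states, and let $|\psi|$ be the number of nodes of the syntax tree of $\psi$. Then there is an algorithm (one program for all $AP$, $k_T$, $k_L$) which, given a universally safe HyperLTL formula $\varphi=\forall\pi_1\dots\forall\pi_{k_T}.\psi$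 and a DFA $\mathcal A$ over $\Sigma^{k_L}$ (given by its transition table), decides whether every word accepted by $\mathcal A$ is a representation of a bad prefix of $\varphi$, and whose running time is polynomial in $|\mathcal A|$, exponential in $|\psi|$ and doubly exponential in $k_T$ whenever $k_L\le k_T$. Precisely, for every finite $AP$ there are polynomials $P,R$ with natural number coefficients such that for all $k_T$, $k_L$, $\varphi$ and $\mathcal A$ as above the algorithm halts with the correct answer after at most $$P(|\mathcal A|)\cdot 2^{\,|\psi|\cdot 2^{R(\max(k_T,k_L))}}$$ steps. Time is measured on a random access machine with unit-cost addition and truncated subtraction. -/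

import Mathlib

/-! ### HyperLTL over the atomic propositions `Fin m`, letters being the sets of propositions -/

/-- The alphabet `Σ = 2^AP` for `AP = Fin m`. -/
abbrev Letter (m : ℕ) : Type := Set (Fin m)

/-- Infinite traces, i.e. elements of `Σ^ω`. -/
abbrev Trace (m : ℕ) : Type := ℕ → Letter m

/-- The suffix `t[i, ∞]`. -/
def Trace.suffix {m : ℕ} (t : Trace m) (i : ℕ) : Trace m := fun j => t (i + j)

/-- Quantifier-free formulas (LTL formulas whose atoms `a_π` are indexed by one of `k` trace
variables). -/
inductive LTL (m k : ℕ) : Type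
  | atom (a : Fin m) (v : Fin k) : LTL m k
  | neg (p : LTL m k) : LTL m k
  | disj (p q : LTL m k) : LTL m k
  | next (p : LTL m k) : LTL m k
  | untl (p q : LTL m k) : LTL m k

namespace LTL

/-- `|ψ|`: the number of nodes of the syntax tree. -/
def size {m k : ℕ} : LTL m k → ℕ
  | atom _ _ => 1
  | neg p => p.size + 1
  | disj p q => p.size + q.size + 1
  | next p => p.size + 1
  | untl p q => p.size + q.size + 1

/-- Satisfaction of a quantifier-free formula under a trace assignment. -/
def Sat {m k : ℕ} : LTL m k → (Fin k → Trace m) → Prop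
  | atom a v, ρ => a ∈ ρ v 0
  | neg p, ρ => ¬ p.Sat ρ
  | disj p q, ρ => p.Sat ρ ∨ q.Sat ρ
  | next p, ρ => p.Sat (fun v => (ρ v).suffix 1)
  | untl p q, ρ => ∃ i, q.Sat (fun v => (ρ v).suffix i) ∧
      ∀ j < i, p.Sat (fun v => (ρ v).suffix j)

/-- `ψ` is a safety LTL formula: every violating word over `Σ^k` has a finite prefix all of whose
infinite extensions are violating. -/
def IsSafety {m k : ℕ} (p : LTL m k) : Prop :=
  ∀ ρ : Fin k → Trace m, ¬ p.Sat ρ →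
    ∃ N : ℕ, ∀ ρ' : Fin k → Trace m, (∀ v, ∀ j < N, ρ' v j = ρ v j) → ¬ p.Sat ρ'

/-- The nodes of the syntax tree in postorder; a node is a triple consisting of its kind and, for
an atom `a_π`, the indices of `a` and of `π`. -/
def postorder {m k : ℕ} : LTL m k → List (ℕ × ℕ × ℕ)
  | atom a v => [(0, (a : ℕ), (v : ℕ))]
  | neg p => p.postorder ++ [(1, 0, 0)]
  | disj p q => p.postorder ++ q.postorder ++ [(2, 0, 0)]
  | next p => p.postorder ++ [(3, 0, 0)]
  | untl p q => p.postorder ++ q.postorder ++ [(4, 0, 0)]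

end LTL

/-- HyperLTL formulas with free trace variables `π_0, …, π_{k-1}`; a quantifier binds the variable
with the largest index of its scope. -/
inductive HyperLTL (m : ℕ) : ℕ → Type
  | qfree {k : ℕ} (p : LTL m k) : HyperLTL m k
  | ex {k : ℕ} (φ : HyperLTL m (k + 1)) : HyperLTL m k
  | all {k : ℕ} (φ : HyperLTL m (k + 1)) : HyperLTL m k

namespace HyperLTL

/-- `ρ ⊨_T φ`. -/
def Sat {m : ℕ} (T : Set (Trace m)) : {k : ℕ} → HyperLTL m k → (Fin k → Trace m) → Prop
  | _, qfree p, ρ => p.Sat ρ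
  | _, ex φ, ρ => ∃ t ∈ T, Sat T φ (Fin.snoc (α := fun _ => Trace m) ρ t)
  | _, all φ, ρ => ∀ t ∈ T, Sat T φ (Fin.snoc (α := fun _ => Trace m) ρ t)

/-- The set of traces `T` satisfies the closed formula `φ`. -/
def Models {m : ℕ} (T : Set (Trace m)) (φ : HyperLTL m 0) : Prop := Sat T φ Fin.elim0

/-- The universal closure `∀ π_0 … ∀ π_{k-1}. φ`. -/
def univClosure {m : ℕ} : (k : ℕ) → HyperLTL m k → HyperLTL m 0
  | 0, φ => φ
  | k + 1, φ => univClosure k (all φ)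

/-- The universal formula `∀ π_0 … ∀ π_{k-1}. ψ`. It is universally safe when `ψ.IsSafety`. -/
def univ {m k : ℕ} (p : LTL m k) : HyperLTL m 0 := univClosure k (qfree p)

end HyperLTL

/-! ### Bad prefixes and their representations -/

/-- The finite trace `t` is a prefix of the infinite trace `τ`. -/
def IsTracePrefix {m : ℕ} (t : List (Letter m)) (τ : Trace m) : Prop :=
  ∀ (j : ℕ) (h : j < t.length), t[j] = τ j

/-- `T ≤ T'` for a set of finite traces and a set of infinite traces. -/
def IsSetPrefix {m : ℕ} (T : Set (List (Letter m))) (T' : Set (Trace m)) : Prop :=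
  ∀ t ∈ T, ∃ t' ∈ T', IsTracePrefix t t'

/-- `T` is a bad prefix of (the hyperproperty given by) `φ`. -/
def IsBadPrefix {m : ℕ} (φ : HyperLTL m 0) (T : Set (List (Letter m))) : Prop :=
  ∀ T' : Set (Trace m), IsSetPrefix T T' → ¬ HyperLTL.Models T' φ

/-- The set of the component words of a word over `Σ^k`. -/
def unzip {m k : ℕ} (w : List (Fin k → Letter m)) : Set (List (Letter m)) :=
  {t | ∃ i : Fin k, t = w.map (fun v => v i)}

/-- The word `w` over `Σ^k` is a representation of the set `T` of finite traces. -/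
def IsRepresentation {m k : ℕ} (w : List (Fin k → Letter m)) (T : Set (List (Letter m))) : Prop :=
  unzip w = T

/-- Every word accepted by the automaton is a representation of a bad prefix of `φ`. -/
def AcceptsOnlyBadPrefixes {m k : ℕ} {Q : Type} (A : DFA (Fin k → Letter m) Q)
    (φ : HyperLTL m 0) : Prop :=
  ∀ w ∈ A.accepts, ∃ T : Set (List (Letter m)), IsBadPrefix φ T ∧ IsRepresentation w T

/-! ### The machine model

Structured programs of a random access machine with unit cost addition and (truncated) subtraction.
The memory consists of arrays of natural numbers; a program names finitely many of them. There is no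
unit cost multiplication, so time on this machine and time on a Turing machine agree up to a
polynomial. -/

namespace RAM

/-- A memory: `s a i` is the content of cell `i` of array `a`. -/
abbrev Store : Type := ℕ → ℕ → ℕ

/-- Expressions; `read a e` is the cell of array `a` whose index is the value of `e`. -/
inductive Expr : Type
  | const (n : ℕ) : Expr
  | read (a : ℕ) (e : Expr) : Expr
  | plus (e f : Expr) : Expr
  | monus (e f : Expr) : Expr

namespace Expr

/-- The value of an expression. -/
def eval (s : Store) : Expr → ℕ
  | const n => n
  | read a e => s a (e.eval s)
  | plus e f => e.eval s + f.eval s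
  | monus e f => e.eval s - f.eval s

/-- The number of steps needed to evaluate an expression. -/
def cost : Expr → ℕ
  | const _ => 1
  | read _ e => e.cost + 1
  | plus e f => e.cost + f.cost + 1
  | monus e f => e.cost + f.cost + 1

end Expr

/-- Programs; `assign a i e` stores the value of `e` in the cell of array `a` whose index is the
value of `i`; `cond` and `loop` test whether the value of an expression is nonzero. -/
inductive Prog : Type
  | skip : Prog
  | assign (a : ℕ) (i e : Expr) : Prog
  | seq (p q : Prog) : Prog
  | cond (e : Expr) (p q : Prog) : Prog
  | loop (e : Expr) (p : Prog) : Prog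

/-- The memory after storing `x` in cell `i` of array `a`. -/
def Store.set (s : Store) (a i x : ℕ) : Store :=
  Function.update s a (Function.update (s a) i x)

/-- `Runs p s t s'`: started in memory `s`, the program `p` halts after exactly `t` steps in
memory `s'`. -/
inductive Runs : Prog → Store → ℕ → Store → Prop
  | skip (s : Store) : Runs Prog.skip s 1 s
  | assign (s : Store) (a : ℕ) (i e : Expr) :
      Runs (Prog.assign a i e) s (i.cost + e.cost + 1) (s.set a (i.eval s) (e.eval s))
  | seq {p q : Prog} {s s' s'' : Store} {t t' : ℕ} :
      Runs p s t s' → Runs q s' t' s'' → Runs (Prog.seq p q) s (t + t') s''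
  | condTrue {e : Expr} {p q : Prog} {s s' : Store} {t : ℕ} :
      e.eval s ≠ 0 → Runs p s t s' → Runs (Prog.cond e p q) s (e.cost + t + 1) s'
  | condFalse {e : Expr} {p q : Prog} {s s' : Store} {t : ℕ} :
      e.eval s = 0 → Runs q s t s' → Runs (Prog.cond e p q) s (e.cost + t + 1) s'
  | loopDone {e : Expr} {p : Prog} {s : Store} :
      e.eval s = 0 → Runs (Prog.loop e p) s (e.cost + 1) s
  | loopStep {e : Expr} {p : Prog} {s s' s'' : Store} {t t' : ℕ} :
      e.eval s ≠ 0 → Runs p s t s' → Runs (Prog.loop e p) s' t' s'' →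
      Runs (Prog.loop e p) s (e.cost + t + t' + 1) s''

/-- Started in memory `s`, the program halts within `B` steps and leaves the truth value of `P`
in cell `0` of array `0`. -/
def DecidesWithin (p : Prog) (s : Store) (P : Prop) (B : ℕ) : Prop :=
  ∃ t ≤ B, ∃ s' : Store, Runs p s t s' ∧ (P → s' 0 0 = 1) ∧ (¬ P → s' 0 0 = 0)

end RAM

/-- The letter of `Σ^k` with number `b < 2^(m * k)`: bit `i * m + a` of `b` says whether `a` belongs
to component `i`. -/
def letterOfNat (m k b : ℕ) : Fin k → Letter m :=
  fun i => {a | b.testBit ((i : ℕ) * m + (a : ℕ)) = true}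

open Classical in
/-- The input: array `0` holds the parameters, arrays `1`, `2`, `3` the nodes of `ψ` in postorder,
array `4` the accepting states and array `5` the transition table (row by row) of the automaton. All
other cells are `0`. -/
noncomputable def inputStore {m kT kL n : ℕ} (p : LTL m kT)
    (A : DFA (Fin kL → Letter m) (Fin n)) : RAM.Store
  | 0, j => [m, kL, kT, p.size, n, (A.start : ℕ)].getD j 0
  | 1, j => (p.postorder.getD j (0, 0, 0)).1
  | 2, j => (p.postorder.getD j (0, 0, 0)).2.1
  | 3, j => (p.postorder.getD j (0, 0, 0)).2.2
  | 4, j => if h : j < n then (if (⟨j, h⟩ : Fin n) ∈ A.accept then 1 else 0) else 0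
  | 5, j => if h : j / 2 ^ (m * kL) < n then
      (A.step ⟨j / 2 ^ (m * kL), h⟩ (letterOfNat m kL (j % 2 ^ (m * kL))) : ℕ) else 0
  | _, _ => 0

/-! The universal formula is preserved when the set of traces shrinks, so the set of component words
of an accepted word fails to be a bad prefix exactly when it has a satisfying extension formed by
one trace per component. A violation is therefore a `kL`-tuple `ρ` of infinite traces that has an
accepted prefix and satisfies `ψ` under each of the `kL ^ kT` ways to assign components to trace
variables (`acceptsOnlyBadPrefixes_iff`).

Such tuples are the fair infinite paths of a tableau graph (`Tableau.exists_word_iff`). A node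
records a state of the automaton, a letter and a truth value for each pair of an assignment `f` and
a position in the syntax tree, which gives `n * 2 ^ (m * kL + kL ^ kT * |ψ|)` nodes. Edges follow
the automaton and impose the one-step unfolding laws; fairness excludes untils that stay pending
forever. By pigeonhole and a lasso argument, fair paths passing an accepting state are described by
the transitive closure of the edge relation alone (`exists_fair_path_iff`). A Floyd-Warshall table
computes this closure, and bounded quantifiers over nodes do the rest.

On the machine side, terms and statements are interpreted over memories and compiled to programs.
All their loops run equally often, namely as often as the cell `s 7 0` (the cap) says, so a
structural induction bounds the running time by a polynomial in the cap whose coefficients depend on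
the program only. The cap has to be exponentially large at the end, and it is raised in four phases,
each computing the numbers from which the next cap is formed by additions (`execList_phases`). The
last cap is polynomial in the number of nodes and the parameters; with `kL ^ kT ≤ 2 ^ (M ^ 2)` for
`M = max kT kL` this is the claimed bound (`BadPrefix.bound_succ_le`). -/

/-! ### A small term language and its compilation to the machine -/

namespace RAM

/-- Terms over a list of variables; `read` looks up a cell of an array other than `6`, and
`iter t u` starts with `t` and applies `u` once for each `i` below the content of cell `0` of
array `7`; in `u`, variable `0` is `i` and variable `1` the current value. The term `drop k t` is
`t` with the variable `k` removed from the context. -/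
inductive Tm : Type
  | const (n : ℕ) : Tm
  | var (i : ℕ) : Tm
  | read (a : ℕ) (t : Tm) : Tm
  | plus (t u : Tm) : Tm
  | monus (t u : Tm) : Tm
  | ite (c t u : Tm) : Tm
  | iter (t u : Tm) : Tm
  | drop (k : ℕ) (t : Tm) : Tm

/-- The number of iterations performed by each loop. -/
def Store.cap (s : Store) : ℕ := s 7 0

namespace Tm

/-- The value of a term. -/
def eval (s : Store) : Tm → List ℕ → ℕ
  | const n, _ => n
  | var i, e => (e[i]?).getD 0
  | read a t, e => if a = 6 then 0 else s a (t.eval s e)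
  | plus t u, e => t.eval s e + u.eval s e
  | monus t u, e => t.eval s e - u.eval s e
  | ite c t u, e => if c.eval s e ≠ 0 then t.eval s e else u.eval s e
  | iter t u, e => Nat.rec (t.eval s e) (fun i x => u.eval s (i :: x :: e)) s.cap
  | drop k t, e => t.eval s (e.eraseIdx k)

/-- The machine expression for the content of register `r`. -/
def reg (r : ℕ) : Expr := Expr.read 6 (Expr.const r)

/-- The program that puts the value of a term into register `d`, the values of the variables being
in the registers listed in `l`. -/
def compile : List ℕ → ℕ → Tm → Prog
  | _, d, const n => Prog.assign 6 (Expr.const d) (Expr.const n)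
  | l, d, var i => Prog.assign 6 (Expr.const d) ((l[i]?).elim (Expr.const 0) reg)
  | l, d, read a t => Prog.seq (compile l d t)
      (Prog.assign 6 (Expr.const d) (if a = 6 then Expr.const 0 else Expr.read a (reg d)))
  | l, d, plus t u => Prog.seq (compile l d t) (Prog.seq (compile l (d + 1) u)
      (Prog.assign 6 (Expr.const d) (Expr.plus (reg d) (reg (d + 1)))))
  | l, d, monus t u => Prog.seq (compile l d t) (Prog.seq (compile l (d + 1) u)
      (Prog.assign 6 (Expr.const d) (Expr.monus (reg d) (reg (d + 1)))))
  | l, d, ite c t u => Prog.seq (compile l d c) (Prog.cond (reg d) (compile l d t) (compile l d u))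
  | l, d, iter t u => Prog.seq (compile l d t) (Prog.seq
      (Prog.assign 6 (Expr.const (d + 1)) (Expr.const 0))
      (Prog.loop (Expr.monus (Expr.read 7 (Expr.const 0)) (reg (d + 1)))
        (Prog.seq (compile ((d + 1) :: d :: l) (d + 2) u)
          (Prog.seq (Prog.assign 6 (Expr.const d) (reg (d + 2)))
            (Prog.assign 6 (Expr.const (d + 1)) (Expr.plus (reg (d + 1)) (Expr.const 1)))))))
  | l, d, drop k t => compile (l.eraseIdx k) d t

/-- A bound for the running time of the compiled term. -/
def cost (C : ℕ) : Tm → ℕ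
  | const _ => 10
  | var _ => 10
  | read _ t => t.cost C + 10
  | plus t u => t.cost C + u.cost C + 10
  | monus t u => t.cost C + u.cost C + 10
  | ite c t u => c.cost C + t.cost C + u.cost C + 10
  | iter t u => t.cost C + C * (u.cost C + 20) + 20
  | drop _ t => t.cost C

end Tm

@[simp] theorem Store.set_same (s : Store) (a i x : ℕ) : s.set a i x a i = x := by
  simp [Store.set]

theorem Store.set_of_ne (s : Store) {a b : ℕ} (h : b ≠ a) (i x : ℕ) : s.set a i x b = s b := by
  simp [Store.set, h]

theorem Store.set_apply (s : Store) (a i x b j : ℕ) :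
    s.set a i x b j = if b = a ∧ j = i then x else s b j := by
  by_cases h : b = a
  · subst h
    by_cases h' : j = i <;> simp [Store.set, h']
  · simp [Store.set, h]

/-- The machine memory `σ` holds the memory `s` outside of the registers, and the values `e` in the
registers `l`, which are below `d`. -/
structure Holds (σ s : Store) (l e : List ℕ) (d : ℕ) : Prop where
  arrays : ∀ a, a ≠ 6 → σ a = s a
  vars : l.map (σ 6) = e
  lt : ∀ r ∈ l, r < d

theorem Holds.mono {σ σ' s : Store} {l e : List ℕ} {d d' : ℕ} (h : Holds σ s l e d)
    (h1 : ∀ a, a ≠ 6 → σ' a = σ a) (h2 : ∀ r < d, σ' 6 r = σ 6 r) (hd : d ≤ d') :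
    Holds σ' s l e d' := by
  refine ⟨fun a ha => (h1 a ha).trans (h.arrays a ha), ?_, fun r hr => (h.lt r hr).trans_le hd⟩
  rw [← h.vars]
  exact List.map_congr_left fun r hr => h2 r (h.lt r hr)

theorem Holds.cons {σ s : Store} {l e : List ℕ} {d r x : ℕ} (h : Holds σ s l e d)
    (hr : r < d) (hx : σ 6 r = x) : Holds σ s (r :: l) (x :: e) d := by
  refine ⟨h.arrays, by simp [h.vars, hx], ?_⟩
  rintro r' hr'
  rcases List.mem_cons.1 hr' with rfl | hr'
  · exact hr
  · exact h.lt _ hr'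

theorem Holds.eraseIdx {σ s : Store} {l e : List ℕ} {d : ℕ} (h : Holds σ s l e d) (k : ℕ) :
    Holds σ s (l.eraseIdx k) (e.eraseIdx k) d := by
  refine ⟨h.arrays, by rw [← h.vars, List.eraseIdx_map], fun r hr => ?_⟩
  exact h.lt r (List.mem_of_mem_eraseIdx hr)

/-- The program `p` runs on `σ` for at most `B` steps and changes only registers from `d` on; it
leaves `x` in register `d`. -/
def Yields (p : Prog) (σ : Store) (B d x : ℕ) : Prop :=
  ∃ t ≤ B, ∃ σ', Runs p σ t σ' ∧ σ' 6 d = x ∧ (∀ a, a ≠ 6 → σ' a = σ a) ∧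
    ∀ r < d, σ' 6 r = σ 6 r

theorem yields_assign {σ : Store} {d x B : ℕ} {e : Expr} (he : e.eval σ = x)
    (hB : e.cost + 2 ≤ B) : Yields (Prog.assign 6 (Expr.const d) e) σ B d x := by
  refine ⟨_, ?_, _, Runs.assign σ 6 (Expr.const d) e, ?_, ?_, ?_⟩
  · simp only [Expr.cost]; omega
  · simp [Expr.eval, he]
  · intro a ha; exact Store.set_of_ne _ ha _ _
  · intro r hr
    rw [Store.set_apply, if_neg]
    simp [Expr.eval]; omega

theorem Yields.seq {p q : Prog} {σ : Store} {B B' d d' x y : ℕ} (h : Yields p σ B d x)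
    (hd : d' ≤ d) (h' : ∀ σ', σ' 6 d = x → (∀ a, a ≠ 6 → σ' a = σ a) →
      (∀ r < d, σ' 6 r = σ 6 r) → Yields q σ' B' d' y) :
    Yields (Prog.seq p q) σ (B + B') d' y := by
  obtain ⟨t, ht, σ', hr, hx, h1, h2⟩ := h
  obtain ⟨t', ht', σ'', hr', hy, h1', h2'⟩ := h' σ' hx h1 h2
  refine ⟨t + t', by omega, σ'', Runs.seq hr hr', hy, ?_, ?_⟩
  · intro a ha; rw [h1' a ha, h1 a ha]
  · intro r hr; rw [h2' r hr, h2 r (by omega)]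

theorem Yields.mono {p : Prog} {σ : Store} {B B' d x : ℕ} (h : Yields p σ B d x) (hB : B ≤ B') :
    Yields p σ B' d x := by
  obtain ⟨t, ht, h⟩ := h
  exact ⟨t, ht.trans hB, h⟩

-- The start index `i` and the accumulator `x` are arbitrary because each machine step continues
-- with the same loop from `i + 1` and `f i x`. The body may overwrite only registers from `d + 2`
-- on, so accumulator `d` and counter `d + 1` survive it.
open Tm in
theorem yields_loop {σ s : Store} {l e : List ℕ} {d b : ℕ} {p : Prog} (f : ℕ → ℕ → ℕ)
    (hp : ∀ (σ : Store) (i x : ℕ), Holds σ s ((d + 1) :: d :: l) (i :: x :: e) (d + 2) →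
      Yields p σ b (d + 2) (f i x)) :
    ∀ (n i x : ℕ), i + n = s.cap → Holds σ s l e d → σ 6 d = x → σ 6 (d + 1) = i →
      ∀ y, y = Nat.rec x (fun k z => f (i + k) z) n →
      Yields (Prog.loop (Expr.monus (Expr.read 7 (Expr.const 0)) (reg (d + 1)))
        (Prog.seq p
          (Prog.seq (Prog.assign 6 (Expr.const d) (reg (d + 2)))
            (Prog.assign 6 (Expr.const (d + 1)) (Expr.plus (reg (d + 1)) (Expr.const 1))))))
        σ (n * (b + 20) + 10) d y := by
  intro n
  induction n generalizing σ with
  | zero =>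
    intro i x hi h hx hi' y hy
    refine ⟨_, ?_, σ, Runs.loopDone ?_, ?_, fun _ _ => rfl, fun _ _ => rfl⟩
    · simp [Expr.cost, reg]
    · have : σ 7 = s 7 := h.arrays 7 (by decide)
      simp only [Expr.eval, reg, this, hi']
      simp only [Store.cap] at hi
      omega
    · simpa [hx] using hy.symm
  | succ n ih =>
    intro i x hi h hx hi' y hy
    have hH : Holds σ s ((d + 1) :: d :: l) (i :: x :: e) (d + 2) :=
      ((h.mono (d' := d + 2) (fun _ _ => rfl) (fun _ _ => rfl) (by omega)).cons (by omega) hx).cons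
        (by omega) hi'
    obtain ⟨t, ht, σ₁, hr, hv, h1, h2⟩ := hp σ i x hH
    have hrun := Runs.seq hr (Runs.seq (Runs.assign σ₁ 6 (Expr.const d) (reg (d + 2)))
      (Runs.assign _ 6 (Expr.const (d + 1)) (Expr.plus (reg (d + 1)) (Expr.const 1))))
    set σ₂ := (σ₁.set 6 ((Expr.const d).eval σ₁) ((reg (d + 2)).eval σ₁)) with hσ₂
    set σ₃ := σ₂.set 6 ((Expr.const (d + 1)).eval σ₂)
      ((Expr.plus (reg (d + 1)) (Expr.const 1)).eval σ₂) with hσ₃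
    have e1 : ∀ a, a ≠ 6 → σ₃ a = σ a := by
      intro a ha
      rw [hσ₃, Store.set_of_ne _ ha, hσ₂, Store.set_of_ne _ ha, h1 a ha]
    have e2 : ∀ r < d, σ₃ 6 r = σ 6 r := by
      intro r hr
      rw [hσ₃, Store.set_apply, if_neg (by simp [Expr.eval]; omega), hσ₂, Store.set_apply,
        if_neg (by simp [Expr.eval]; omega), h2 r (by omega)]
    have e3 : σ₃ 6 d = f i x := by
      rw [hσ₃, Store.set_apply, if_neg (by simp [Expr.eval]), hσ₂, Store.set_apply,
        if_pos (by simp [Expr.eval])]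
      simp [Expr.eval, reg, hv]
    have e4 : σ₃ 6 (d + 1) = i + 1 := by
      rw [hσ₃, Store.set_apply, if_pos (by simp [Expr.eval])]
      simp only [Expr.eval, reg]
      rw [hσ₂, Store.set_apply, if_neg (by simp [Expr.eval]), h2 _ (by omega), hi']
    obtain ⟨t', ht', σ', hr', hy', h1', h2'⟩ := ih (σ := σ₃) (i + 1) (f i x) (by omega)
      (h.mono e1 e2 le_rfl) e3 e4 y (by
        rw [hy]
        -- The machine peels off the first iteration, `Nat.rec` the last one; this induction
        -- reconciles the two.
        clear * -
        induction n with
        | zero => simp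
        | succ n ih =>
          simp only at ih ⊢
          rw [ih, show i + (n + 1) = i + 1 + n by omega])
    refine ⟨_, ?_, σ', Runs.loopStep ?_ hrun hr', hy', ?_, ?_⟩
    · simp only [Expr.cost, reg]
      have : (n + 1) * (b + 20) = n * (b + 20) + b + 20 := by ring
      omega
    · have : σ 7 = s 7 := h.arrays 7 (by decide)
      simp only [Expr.eval, reg, this, hi']
      simp only [Store.cap] at hi
      omega
    · intro a ha; rw [h1' a ha, e1 a ha]
    · intro r hr; rw [h2' r hr, e2 r hr]

namespace Tm

/-- The stack discipline makes the induction work: variables live in registers below `d`, the code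
for a subterm writes only from its target on, and so pending intermediate results in lower registers
are never lost. -/
theorem yields_compile (t : Tm) : ∀ {σ s : Store} {l e : List ℕ} {d : ℕ}, Holds σ s l e d →
    Yields (compile l d t) σ (t.cost s.cap) d (t.eval s e) := by
  induction t with
  | const n =>
    intro σ s l e d h
    exact yields_assign rfl (by simp [Expr.cost, cost])
  | var i =>
    intro σ s l e d h
    refine yields_assign ?_ ?_
    · rw [← h.vars]
      simp only [eval, List.getElem?_map]
      cases l[i]? <;> simp [Expr.eval, reg]
    · cases l[i]? <;> simp [Expr.cost, reg, cost]
  | read a t ih =>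
    intro σ s l e d h
    refine (ih h).seq le_rfl fun σ' hx h1 h2 => yields_assign ?_ ?_
    · by_cases ha : a = 6
      · simp [ha, Expr.eval, eval]
      · simp [ha, Expr.eval, eval, reg, hx, h1 a ha, h.arrays a ha]
    · split_ifs <;> simp [Expr.cost, reg]
  | plus t u iht ihu =>
    intro σ s l e d h
    refine ((iht h).seq le_rfl fun σ' hx h1 h2 =>
      (ihu (h.mono h1 h2 (Nat.le_succ d))).seq (Nat.le_succ d) fun σ'' hx' h1' h2' =>
        yields_assign (B := 10) ?_ ?_).mono ?_
    · simp [Expr.eval, reg, eval, hx', h2' d (Nat.lt_succ_self d), hx]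
    · simp [Expr.cost, reg]
    · simp only [cost]; omega
  | monus t u iht ihu =>
    intro σ s l e d h
    refine ((iht h).seq le_rfl fun σ' hx h1 h2 =>
      (ihu (h.mono h1 h2 (Nat.le_succ d))).seq (Nat.le_succ d) fun σ'' hx' h1' h2' =>
        yields_assign (B := 10) ?_ ?_).mono ?_
    · simp [Expr.eval, reg, eval, hx', h2' d (Nat.lt_succ_self d), hx]
    · simp [Expr.cost, reg]
    · simp only [cost]; omega
  | ite c t u ihc iht ihu =>
    intro σ s l e d h
    refine ((ihc h).seq le_rfl (B' := t.cost s.cap + u.cost s.cap + 10)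
      fun σ' hx h1 h2 => ?_).mono ?_
    · have hev : (reg d).eval σ' = c.eval s e := by simp [reg, Expr.eval, hx]
      by_cases hc : c.eval s e = 0
      · obtain ⟨B, hB, σ'', hr, hy, h1', h2'⟩ := ihu (h.mono h1 h2 le_rfl)
        refine ⟨_, ?_, σ'', Runs.condFalse (hev.trans hc) hr, ?_, h1', h2'⟩
        · simp only [reg, Expr.cost]; omega
        · simp [eval, hc, hy]
      · obtain ⟨B, hB, σ'', hr, hy, h1', h2'⟩ := iht (h.mono h1 h2 le_rfl)
        refine ⟨_, ?_, σ'', Runs.condTrue (by rwa [hev]) hr, ?_, h1', h2'⟩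
        · simp only [reg, Expr.cost]; omega
        · simp [eval, hc, hy]
    · simp only [cost]; omega
  | iter t u iht ihu =>
    intro σ s l e d h
    refine ((iht h).seq le_rfl (B' := s.cap * (u.cost s.cap + 20) + 20)
      fun σ' hx h1 h2 => ?_).mono ?_
    · have hz : Yields (Prog.assign 6 (Expr.const (d + 1)) (Expr.const 0)) σ' 10 (d + 1) 0 :=
        yields_assign rfl (by simp [Expr.cost])
      refine (hz.seq (Nat.le_succ d) (B' := s.cap * (u.cost s.cap + 20) + 10)
        fun σ'' hx' h1' h2' => ?_).mono (by omega)
      refine yields_loop (s := s) (e := e) (l := l) (fun i x => u.eval s (i :: x :: e))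
        (fun σ i x hH => ihu hH) s.cap 0 (t.eval s e) (by omega) ?_ ?_ hx' _ ?_
      · exact (h.mono h1 h2 le_rfl).mono h1' (fun r hr => h2' r (by omega)) le_rfl
      · rw [h2' d (Nat.lt_succ_self d), hx]
      · simp [eval]
    · simp only [cost]; omega
  | drop k t ih =>
    intro σ s l e d h
    exact ih (h.eraseIdx k)

/-- The compiled term runs in time polynomial in the number of iterations of a loop. -/
theorem exists_cost_le (t : Tm) : ∃ c k, ∀ C, t.cost C ≤ c * (C + 1) ^ k := by
  -- Bounds of the form `c * (C + 1) ^ k` are closed under sums; a loop contributes one further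
  -- factor `C + 1`.
  have key : ∀ (c k c' k' C : ℕ), c * (C + 1) ^ k + c' * (C + 1) ^ k' ≤
      (c + c') * (C + 1) ^ (k + k') := by
    intro c k c' k' C
    rw [add_mul]
    exact Nat.add_le_add (Nat.mul_le_mul_left _ (Nat.pow_le_pow_right (by omega) (by omega)))
      (Nat.mul_le_mul_left _ (Nat.pow_le_pow_right (by omega) (by omega)))
  induction t with
  | const n => exact ⟨10, 0, fun C => by simp [cost]⟩
  | var i => exact ⟨10, 0, fun C => by simp [cost]⟩
  | read a t ih =>
    obtain ⟨c, k, h⟩ := ih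
    refine ⟨c + 10, k + 0, fun C => le_trans ?_ (key _ _ _ _ C)⟩
    simpa [cost] using h C
  | plus t u iht ihu =>
    obtain ⟨c, k, h⟩ := iht
    obtain ⟨c', k', h'⟩ := ihu
    refine ⟨c + c' + 10, k + k' + 0, fun C => le_trans ?_ (key _ _ _ _ C)⟩
    have := key c k c' k' C
    have := h C
    have := h' C
    simp only [cost, pow_zero]; omega
  | monus t u iht ihu =>
    obtain ⟨c, k, h⟩ := iht
    obtain ⟨c', k', h'⟩ := ihu
    refine ⟨c + c' + 10, k + k' + 0, fun C => le_trans ?_ (key _ _ _ _ C)⟩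
    have := key c k c' k' C
    have := h C
    have := h' C
    simp only [cost, pow_zero]; omega
  | ite a t u iha iht ihu =>
    obtain ⟨c, k, h⟩ := iht
    obtain ⟨c', k', h'⟩ := ihu
    obtain ⟨c'', k'', h''⟩ := iha
    refine ⟨c'' + (c + c') + 10, k'' + (k + k') + 0, fun C => le_trans ?_ (key _ _ _ _ C)⟩
    have := key c k c' k' C
    have := key c'' k'' (c + c') (k + k') C
    have := h C
    have := h' C
    have := h'' C
    simp only [cost, pow_zero]; omega
  | iter t u iht ihu =>
    obtain ⟨c, k, h⟩ := iht
    obtain ⟨c', k', h'⟩ := ihu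
    refine ⟨c + (c' + 40), k + (k' + 1), fun C => le_trans ?_ (key _ _ _ _ C)⟩
    have h1 := h C
    have h2 : C * (u.cost C + 20) + 20 ≤ (c' + 40) * (C + 1) ^ (k' + 1) := by
      have h3 := h' C
      have h4 : 1 ≤ (C + 1) ^ k' := Nat.one_le_pow _ _ (by omega)
      calc C * (u.cost C + 20) + 20
          ≤ (C + 1) * (u.cost C + 40) := by nlinarith
        _ ≤ (C + 1) * ((c' + 40) * (C + 1) ^ k') := by
            refine Nat.mul_le_mul_left _ ?_
            nlinarith
        _ = _ := by ring
    simp only [cost]; omega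
  | drop k t ih => exact ih

end Tm

end RAM

/-! ### Statements that modify the memory, and their compilation -/

namespace RAM

/-- Statements: `set` stores a value in a cell (of an array other than `6` and `7`), `all p`
runs `p` once for each `i` below the content of cell `0` of array `7`, with variable `0` being
`i`. -/
inductive Stmt : Type
  | set (a : ℕ) (i v : Tm) : Stmt
  | seq (p q : Stmt) : Stmt
  | guard (c : Tm) (p : Stmt) : Stmt
  | all (p : Stmt) : Stmt

namespace Stmt

/-- The memory after the execution of a statement. -/
def exec : Stmt → List ℕ → Store → Store
  | set a i v, e, s => if a = 6 ∨ a = 7 then s else s.set a (i.eval s e) (v.eval s e)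
  | seq p q, e, s => q.exec e (p.exec e s)
  | guard c p, e, s => if c.eval s e ≠ 0 then p.exec e s else s
  | all p, e, s => Nat.rec s (fun i s' => p.exec (i :: e) s') s.cap

/-- The program for a statement. -/
def compile : List ℕ → ℕ → Stmt → Prog
  | l, d, set a i v => if a = 6 ∨ a = 7 then Prog.skip else
      Prog.seq (i.compile l d) (Prog.seq (v.compile l (d + 1))
        (Prog.assign a (Tm.reg d) (Tm.reg (d + 1))))
  | l, d, seq p q => Prog.seq (compile l d p) (compile l d q)
  | l, d, guard c p => Prog.seq (c.compile l d) (Prog.cond (Tm.reg d) (compile l d p) Prog.skip)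
  | l, d, all p => Prog.seq (Prog.assign 6 (Expr.const d) (Expr.const 0))
      (Prog.loop (Expr.monus (Expr.read 7 (Expr.const 0)) (Tm.reg d))
        (Prog.seq (compile (d :: l) (d + 1) p)
          (Prog.assign 6 (Expr.const d) (Expr.plus (Tm.reg d) (Expr.const 1)))))

/-- A bound for the running time of a compiled statement. -/
def cost (C : ℕ) : Stmt → ℕ
  | set _ i v => i.cost C + v.cost C + 10
  | seq p q => p.cost C + q.cost C
  | guard c p => c.cost C + p.cost C + 10
  | all p => C * (p.cost C + 20) + 20

theorem exec_seven (p : Stmt) : ∀ (e : List ℕ) (s : Store), p.exec e s 7 = s 7 := by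
  induction p with
  | set a i v =>
    intro e s
    simp only [exec]
    split_ifs with h
    · rfl
    · exact Store.set_of_ne _ (by omega) _ _
  | seq p q ihp ihq => intro e s; rw [exec, ihq, ihp]
  | guard c p ih => intro e s; simp only [exec]; split_ifs <;> simp [ih]
  | all p ih =>
    intro e s
    simp only [exec]
    induction s.cap with
    | zero => rfl
    | succ n hn => simp only; rw [ih, hn]

/-- Statements cannot write to array `7`. Hence all loops of a statement run equally often, and one
number controls the cost of the whole statement. -/
theorem cap_exec (p : Stmt) (e : List ℕ) (s : Store) : (p.exec e s).cap = s.cap := by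
  simp [Store.cap, exec_seven]

/-- The invariant rule for loops, by which all table-filling programs below are verified. -/
theorem all_induction {p : Stmt} {e : List ℕ} {s : Store} (I : ℕ → Store → Prop) (h0 : I 0 s)
    (hs : ∀ i < s.cap, ∀ s', I i s' → I (i + 1) (p.exec (i :: e) s')) :
    I s.cap ((all p).exec e s) := by
  have : ∀ n ≤ s.cap, I n (Nat.rec s (fun i s' => p.exec (i :: e) s') n) := by
    intro n
    induction n with
    | zero => intro _; exact h0
    | succ n ih => intro hn; exact hs n hn _ (ih (by omega))
  exact this _ le_rfl

/-- The program `p` runs on `σ` for at most `B` steps, changing only registers from `d` on and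
otherwise leading to memory `s'`. -/
def Leads (p : Prog) (σ : Store) (B d : ℕ) (s' : Store) : Prop :=
  ∃ t ≤ B, ∃ σ', Runs p σ t σ' ∧ (∀ a, a ≠ 6 → σ' a = s' a) ∧ ∀ r < d, σ' 6 r = σ 6 r

/-- As in `yields_loop`, but the memory itself is the accumulator. The hypothesis on the body is
therefore required for every memory with cap `C`, which `cap_exec` maintains. -/
theorem leads_loop {l e : List ℕ} {d b C : ℕ} {p : Stmt}
    (hp : ∀ (σ s : Store) (i : ℕ), s.cap = C → Holds σ s (d :: l) (i :: e) (d + 1) →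
      Leads (p.compile (d :: l) (d + 1)) σ b (d + 1) (p.exec (i :: e) s)) :
    ∀ (n i : ℕ) (σ s : Store), s.cap = C → i + n = C → Holds σ s l e d → σ 6 d = i →
      ∀ s', s' = Nat.rec s (fun k s' => p.exec ((i + k) :: e) s') n →
      Leads (Prog.loop (Expr.monus (Expr.read 7 (Expr.const 0)) (Tm.reg d))
        (Prog.seq (compile (d :: l) (d + 1) p)
          (Prog.assign 6 (Expr.const d) (Expr.plus (Tm.reg d) (Expr.const 1)))))
        σ (n * (b + 20) + 10) d s' := by
  intro n
  induction n with
  | zero =>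
    intro i σ s hC hi h hi' s' hs'
    refine ⟨_, ?_, σ, Runs.loopDone ?_, ?_, fun _ _ => rfl⟩
    · simp [Expr.cost, Tm.reg]
    · have : σ 7 = s 7 := h.arrays 7 (by decide)
      simp only [Expr.eval, Tm.reg, this, hi']
      simp only [Store.cap] at hC
      omega
    · subst hs'; exact h.arrays
  | succ n ih =>
    intro i σ s hC hi h hi' s' hs'
    have hH : Holds σ s (d :: l) (i :: e) (d + 1) :=
      (h.mono (d' := d + 1) (fun _ _ => rfl) (fun _ _ => rfl) (by omega)).cons (by omega) hi'
    obtain ⟨t, ht, σ₁, hr, h1, h2⟩ := hp σ s i hC hH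
    have hrun := Runs.seq hr
      (Runs.assign σ₁ 6 (Expr.const d) (Expr.plus (Tm.reg d) (Expr.const 1)))
    set σ₃ := σ₁.set 6 ((Expr.const d).eval σ₁)
      ((Expr.plus (Tm.reg d) (Expr.const 1)).eval σ₁) with hσ₃
    have e1 : ∀ a, a ≠ 6 → σ₃ a = p.exec (i :: e) s a := by
      intro a ha
      rw [hσ₃, Store.set_of_ne _ ha, h1 a ha]
    have e2 : ∀ r < d, σ₃ 6 r = σ 6 r := by
      intro r hr
      rw [hσ₃, Store.set_apply, if_neg (by simp [Expr.eval]; omega), h2 r (by omega)]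
    have e4 : σ₃ 6 d = i + 1 := by
      rw [hσ₃, Store.set_apply, if_pos (by simp [Expr.eval])]
      simp only [Expr.eval, Tm.reg]
      rw [h2 _ (by omega), hi']
    have hH' : Holds σ₃ (p.exec (i :: e) s) l e d := by
      refine ⟨e1, ?_, h.lt⟩
      rw [← h.vars]
      exact List.map_congr_left fun r hr => e2 r (h.lt r hr)
    obtain ⟨t', ht', σ', hr', h1', h2'⟩ := ih (i + 1) σ₃ (p.exec (i :: e) s)
      (by rw [cap_exec, hC]) (by omega) hH' e4 s' (by
        rw [hs']
        clear * -
        induction n with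
        | zero => simp
        | succ n ih =>
          simp only at ih ⊢
          rw [ih, show i + (n + 1) = i + 1 + n by omega])
    refine ⟨_, ?_, σ', Runs.loopStep ?_ hrun hr', h1', ?_⟩
    · simp only [Expr.cost, Tm.reg]
      have : (n + 1) * (b + 20) = n * (b + 20) + b + 20 := by ring
      omega
    · have : σ 7 = s 7 := h.arrays 7 (by decide)
      simp only [Expr.eval, Tm.reg, this, hi']
      simp only [Store.cap] at hC
      omega
    · intro r hr; rw [h2' r hr, e2 r hr]

theorem leads_compile (p : Stmt) : ∀ {σ s : Store} {l e : List ℕ} {d : ℕ}, Holds σ s l e d →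
    Leads (p.compile l d) σ (p.cost s.cap) d (p.exec e s) := by
  induction p with
  | set a i v =>
    intro σ s l e d h
    by_cases ha : a = 6 ∨ a = 7
    · simp only [compile, exec, if_pos ha]
      exact ⟨1, by simp only [cost]; omega, σ, Runs.skip σ, h.arrays, fun _ _ => rfl⟩
    · simp only [compile, exec, if_neg ha]
      push Not at ha
      obtain ⟨t, ht, σ₁, hr, hx, h1, h2⟩ := i.yields_compile h
      obtain ⟨t', ht', σ₂, hr', hx', h1', h2'⟩ :=
        v.yields_compile (h.mono h1 h2 (Nat.le_succ d))
      refine ⟨_, ?_, _, Runs.seq hr (Runs.seq hr' (Runs.assign _ a _ _)), ?_, ?_⟩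
      · simp only [Expr.cost, Tm.reg, cost]; omega
      · intro b hb
        have e1 : (Tm.reg d).eval σ₂ = i.eval s e := by
          simp [Tm.reg, Expr.eval, h2' d (Nat.lt_succ_self d), hx]
        have e2 : (Tm.reg (d + 1)).eval σ₂ = v.eval s e := by
          simp [Tm.reg, Expr.eval, hx']
        rw [e1, e2]
        funext j
        rw [Store.set_apply, Store.set_apply, h1' b hb, h1 b hb, h.arrays b hb]
      · intro r hr
        rw [Store.set_of_ne _ ha.1.symm, h2' r (by omega), h2 r hr]
  | seq p q ihp ihq =>
    intro σ s l e d h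
    obtain ⟨t, ht, σ₁, hr, h1, h2⟩ := ihp h
    have hH : Holds σ₁ (p.exec e s) l e d := by
      refine ⟨h1, ?_, h.lt⟩
      rw [← h.vars]
      exact List.map_congr_left fun r hr => h2 r (h.lt r hr)
    obtain ⟨t', ht', σ₂, hr', h1', h2'⟩ := ihq hH
    rw [cap_exec] at ht'
    refine ⟨t + t', by simp only [cost]; omega, σ₂, Runs.seq hr hr', h1', fun r hr => ?_⟩
    rw [h2' r hr, h2 r hr]
  | guard c p ih =>
    intro σ s l e d h
    obtain ⟨t, ht, σ₁, hr, hx, h1, h2⟩ := c.yields_compile h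
    have hev : (Tm.reg d).eval σ₁ = c.eval s e := by simp [Tm.reg, Expr.eval, hx]
    by_cases hc : c.eval s e = 0
    · refine ⟨_, ?_, σ₁, Runs.seq hr (Runs.condFalse (hev.trans hc) (Runs.skip _)), ?_, h2⟩
      · simp only [cost, Tm.reg, Expr.cost]; omega
      · simp only [exec, hc]
        intro a ha
        simp [h1 a ha, h.arrays a ha]
    · obtain ⟨t', ht', σ₂, hr', h1', h2'⟩ := ih (h.mono h1 h2 le_rfl)
      refine ⟨_, ?_, σ₂, Runs.seq hr (Runs.condTrue (by rwa [hev]) hr'), ?_, ?_⟩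
      · simp only [cost, Tm.reg, Expr.cost]; omega
      · simpa [exec, hc] using h1'
      · intro r hr; rw [h2' r hr, h2 r hr]
  | all p ih =>
    intro σ s l e d h
    obtain ⟨t, ht, σ₁, hr, hx, h1, h2⟩ := yields_assign (σ := σ) (d := d) (x := 0) (B := 10)
      (e := Expr.const 0) rfl (by simp [Expr.cost])
    obtain ⟨t', ht', σ₂, hr', h1', h2'⟩ := leads_loop (l := l) (e := e) (d := d)
      (b := p.cost s.cap) (C := s.cap) (p := p)
      (fun σ s' i hC hH => by rw [← hC]; exact ih hH) s.cap 0 σ₁ s rfl (by omega)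
      (h.mono h1 h2 le_rfl) hx ((all p).exec e s) (by simp [exec])
    refine ⟨_, ?_, σ₂, Runs.seq hr hr', h1', ?_⟩
    · simp only [cost]; omega
    · intro r hr; rw [h2' r hr, h2 r hr]

theorem exists_cost_le (p : Stmt) : ∃ c k, ∀ C, p.cost C ≤ c * (C + 1) ^ k := by
  have key : ∀ (c k c' k' C : ℕ), c * (C + 1) ^ k + c' * (C + 1) ^ k' ≤
      (c + c') * (C + 1) ^ (k + k') := by
    intro c k c' k' C
    rw [add_mul]
    exact Nat.add_le_add (Nat.mul_le_mul_left _ (Nat.pow_le_pow_right (by omega) (by omega)))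
      (Nat.mul_le_mul_left _ (Nat.pow_le_pow_right (by omega) (by omega)))
  induction p with
  | set a i v =>
    obtain ⟨c, k, h⟩ := i.exists_cost_le
    obtain ⟨c', k', h'⟩ := v.exists_cost_le
    refine ⟨c + c' + 10, k + k' + 0, fun C => le_trans ?_ (key _ _ _ _ C)⟩
    have := key c k c' k' C
    have := h C
    have := h' C
    simp only [cost, pow_zero]; omega
  | seq p q ihp ihq =>
    obtain ⟨c, k, h⟩ := ihp
    obtain ⟨c', k', h'⟩ := ihq
    exact ⟨c + c', k + k', fun C => le_trans (Nat.add_le_add (h C) (h' C)) (key _ _ _ _ C)⟩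
  | guard a p ih =>
    obtain ⟨c, k, h⟩ := a.exists_cost_le
    obtain ⟨c', k', h'⟩ := ih
    refine ⟨c + c' + 10, k + k' + 0, fun C => le_trans ?_ (key _ _ _ _ C)⟩
    have := key c k c' k' C
    have := h C
    have := h' C
    simp only [cost, pow_zero]; omega
  | all p ih =>
    obtain ⟨c', k', h'⟩ := ih
    refine ⟨c' + 40, k' + 1, fun C => ?_⟩
    have h3 := h' C
    have h4 : 1 ≤ (C + 1) ^ k' := Nat.one_le_pow _ _ (by omega)
    calc C * (p.cost C + 20) + 20
        ≤ (C + 1) * (p.cost C + 40) := by nlinarith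
      _ ≤ (C + 1) * ((c' + 40) * (C + 1) ^ k') := by
          refine Nat.mul_le_mul_left _ ?_
          nlinarith
      _ = _ := by ring

end Stmt

/-! ### Phases with increasing loop bounds -/

/-- A phase fixes the number of iterations of all loops of a statement. -/
structure Phase : Type where
  bound : Tm
  body : Stmt

namespace Phase

/-- The memory in which the statement of a phase is executed. -/
def start (P : Phase) (s : Store) : Store := s.set 7 0 (P.bound.eval s [])

/-- The memory after a phase. -/
def exec (P : Phase) (s : Store) : Store := P.body.exec [] (P.start s)

/-- The program for a phase. -/
def compile (P : Phase) : Prog :=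
  Prog.seq (P.bound.compile [] 0) (Prog.seq (Prog.assign 7 (Expr.const 0) (Tm.reg 0))
    (P.body.compile [] 0))

/-- The memory after a list of phases. -/
def execList (l : List Phase) (s : Store) : Store := l.foldl (fun s P => P.exec s) s

/-- The program for a list of phases. -/
def compileList (l : List Phase) : Prog := l.foldr (fun P q => Prog.seq P.compile q) Prog.skip

/-- No loop is iterated more than `B` times. -/
def BoundedBy (B : ℕ) : List Phase → Store → Prop
  | [], _ => True
  | P :: l, s => s.cap ≤ B ∧ (P.start s).cap ≤ B ∧ BoundedBy B l (P.exec s)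

/-- Two caps enter: the new bound is evaluated under the old cap, the body runs under the new one.
The constants `c` and `k` come before the memory, so they depend on the phase only. -/
theorem exists_runs (P : Phase) : ∃ c k, ∀ (σ s : Store) (B : ℕ), (∀ a, a ≠ 6 → σ a = s a) →
    s.cap ≤ B → (P.start s).cap ≤ B → ∃ t ≤ c * (B + 1) ^ k, ∃ σ',
      Runs P.compile σ t σ' ∧ ∀ a, a ≠ 6 → σ' a = P.exec s a := by
  obtain ⟨c, k, h⟩ := P.bound.exists_cost_le
  obtain ⟨c', k', h'⟩ := P.body.exists_cost_le
  refine ⟨c + c' + 10, k + k', fun σ s B hσ hs hB => ?_⟩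
  have hH : Holds σ s [] [] 0 := ⟨hσ, rfl, by simp⟩
  obtain ⟨t, ht, σ₁, hr, hx, h1, h2⟩ := P.bound.yields_compile hH
  have hr₂ := Runs.assign σ₁ 7 (Expr.const 0) (Tm.reg 0)
  set σ₂ := σ₁.set 7 ((Expr.const 0).eval σ₁) ((Tm.reg 0).eval σ₁) with hσ₂
  have hH₂ : Holds σ₂ (P.start s) [] [] 0 := by
    refine ⟨fun a ha => ?_, rfl, by simp⟩
    funext j
    rw [hσ₂, start, Store.set_apply, Store.set_apply, h1 a ha, hσ a ha]
    simp [Expr.eval, Tm.reg, hx]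
  obtain ⟨t', ht', σ₃, hr', h1', h2'⟩ := P.body.leads_compile hH₂
  refine ⟨_, ?_, σ₃, Runs.seq hr (Runs.seq hr₂ hr'), h1'⟩
  have b1 : t ≤ c * (B + 1) ^ (k + k') := ht.trans ((h _).trans (Nat.mul_le_mul_left _
    ((Nat.pow_le_pow_left (by omega) _).trans (Nat.pow_le_pow_right (by omega) (by omega)))))
  have b2 : t' ≤ c' * (B + 1) ^ (k + k') := ht'.trans ((h' _).trans (Nat.mul_le_mul_left _
    ((Nat.pow_le_pow_left (by omega) _).trans (Nat.pow_le_pow_right (by omega) (by omega)))))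
  have b3 : 1 ≤ (B + 1) ^ (k + k') := Nat.one_le_pow _ _ (by omega)
  simp only [Expr.cost, Tm.reg]
  nlinarith

theorem exists_runs_list (l : List Phase) : ∃ c k, ∀ (σ s : Store) (B : ℕ),
    (∀ a, a ≠ 6 → σ a = s a) → BoundedBy B l s → ∃ t ≤ c * (B + 1) ^ k, ∃ σ',
      Runs (compileList l) σ t σ' ∧ ∀ a, a ≠ 6 → σ' a = execList l s a := by
  induction l with
  | nil =>
    refine ⟨1, 0, fun σ s B hσ _ => ⟨1, by simp, σ, Runs.skip σ, hσ⟩⟩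
  | cons P l ih =>
    obtain ⟨c, k, h⟩ := P.exists_runs
    obtain ⟨c', k', h'⟩ := ih
    refine ⟨c + c', k + k', fun σ s B hσ hB => ?_⟩
    obtain ⟨t, ht, σ₁, hr, h1⟩ := h σ s B hσ hB.1 hB.2.1
    obtain ⟨t', ht', σ₂, hr', h2⟩ := h' σ₁ _ B h1 hB.2.2
    refine ⟨t + t', ?_, σ₂, Runs.seq hr hr', h2⟩
    rw [add_mul]
    exact Nat.add_le_add
      (ht.trans (Nat.mul_le_mul_left _ (Nat.pow_le_pow_right (by omega) (by omega))))
      (ht'.trans (Nat.mul_le_mul_left _ (Nat.pow_le_pow_right (by omega) (by omega))))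

end Phase

end RAM

/-! ### Positions of the subformulas -/

namespace LTL

variable {m k : ℕ}

/-- The subformulas in postorder. -/
def subs : LTL m k → List (LTL m k)
  | atom a v => [atom a v]
  | neg p => p.subs ++ [neg p]
  | disj p q => p.subs ++ q.subs ++ [disj p q]
  | next p => p.subs ++ [next p]
  | untl p q => p.subs ++ q.subs ++ [untl p q]

/-- The description of the root of the syntax tree. -/
def label : LTL m k → ℕ × ℕ × ℕ
  | atom a v => (0, (a : ℕ), (v : ℕ))
  | neg _ => (1, 0, 0)
  | disj _ _ => (2, 0, 0)
  | next _ => (3, 0, 0)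
  | untl _ _ => (4, 0, 0)

theorem postorder_eq (p : LTL m k) : p.postorder = p.subs.map label := by
  induction p <;> simp_all [postorder, subs, label]

@[simp] theorem length_subs (p : LTL m k) : p.subs.length = p.size := by
  induction p <;> simp_all [subs, size, add_assoc]

theorem size_pos (p : LTL m k) : 0 < p.size := by
  cases p <;> simp [size]

theorem getElem?_subs_root (p : LTL m k) : p.subs[p.size - 1]? = some p := by
  cases p with
  | atom a v => simp [subs, size]
  | neg p => simp [subs, size]
  | next p => simp [subs, size]
  | disj p q =>
    rw [subs, List.getElem?_append_right (by simp [size])]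
    simp [size]
  | untl p q =>
    rw [subs, List.getElem?_append_right (by simp [size])]
    simp [size]

/-- The children of the formula `p` at position `j` are at the right positions. -/
def ChildrenAt (l : List (LTL m k)) (j : ℕ) : LTL m k → Prop
  | atom _ _ => True
  | neg p => ∃ i, j = i + 1 ∧ l[i]? = some p
  | next p => ∃ i, j = i + 1 ∧ l[i]? = some p
  | disj p q => ∃ i, j = i + q.size + 1 ∧ l[i]? = some p ∧ l[i + q.size]? = some q
  | untl p q => ∃ i, j = i + q.size + 1 ∧ l[i]? = some p ∧ l[i + q.size]? = some q

theorem ChildrenAt.append_right {l l' : List (LTL m k)} {j : ℕ} {p : LTL m k}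
    (h : ChildrenAt l j p) : ChildrenAt (l ++ l') j p := by
  have key : ∀ {i : ℕ} {q : LTL m k}, l[i]? = some q → (l ++ l')[i]? = some q := by
    intro i q hq
    rw [List.getElem?_append_left (List.getElem?_eq_some_iff.1 hq).1, hq]
  cases p with
  | atom a v => trivial
  | neg p => obtain ⟨i, h1, h2⟩ := h; exact ⟨i, h1, key h2⟩
  | next p => obtain ⟨i, h1, h2⟩ := h; exact ⟨i, h1, key h2⟩
  | disj p q => obtain ⟨i, h1, h2, h3⟩ := h; exact ⟨i, h1, key h2, key h3⟩
  | untl p q => obtain ⟨i, h1, h2, h3⟩ := h; exact ⟨i, h1, key h2, key h3⟩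

theorem ChildrenAt.append_left {l l' : List (LTL m k)} {j : ℕ} {p : LTL m k}
    (h : ChildrenAt l j p) : ChildrenAt (l' ++ l) (l'.length + j) p := by
  have key : ∀ {i : ℕ} {q : LTL m k}, l[i]? = some q →
      (l' ++ l)[l'.length + i]? = some q := by
    intro i q hq
    rw [List.getElem?_append_right (by omega), Nat.add_sub_cancel_left, hq]
  cases p with
  | atom a v => trivial
  | neg p => obtain ⟨i, h1, h2⟩ := h; exact ⟨l'.length + i, by omega, key h2⟩
  | next p => obtain ⟨i, h1, h2⟩ := h; exact ⟨l'.length + i, by omega, key h2⟩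
  | disj p q =>
    obtain ⟨i, h1, h2, h3⟩ := h
    exact ⟨l'.length + i, by omega, key h2, by rw [add_assoc]; exact key h3⟩
  | untl p q =>
    obtain ⟨i, h1, h2, h3⟩ := h
    exact ⟨l'.length + i, by omega, key h2, by rw [add_assoc]; exact key h3⟩

/-- All formulas of a list have their children at the right positions. -/
def ChildClosed (l : List (LTL m k)) : Prop := ∀ j p, l[j]? = some p → ChildrenAt l j p

theorem ChildClosed.append {l l' : List (LTL m k)} (h : ChildClosed l) (h' : ChildClosed l') :
    ChildClosed (l ++ l') := by
  intro j p hp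
  by_cases hj : j < l.length
  · rw [List.getElem?_append_left hj] at hp
    exact (h j p hp).append_right
  · rw [List.getElem?_append_right (by omega)] at hp
    have := (h' _ p hp).append_left (l' := l)
    rwa [Nat.add_sub_cancel' (by omega)] at this

theorem ChildClosed.snoc {l : List (LTL m k)} {p : LTL m k} (h : ChildClosed l)
    (hp : ChildrenAt l l.length p) : ChildClosed (l ++ [p]) := by
  intro j q hq
  by_cases hj : j < l.length
  · rw [List.getElem?_append_left hj] at hq
    exact (h j q hq).append_right
  · rw [List.getElem?_append_right (by omega)] at hq
    obtain ⟨h1, h2⟩ := List.getElem?_eq_some_iff.1 hq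
    simp only [List.length_singleton] at h1
    have hj' : j = l.length := by omega
    subst hj'
    simp only [List.getElem_singleton] at h2
    subst h2
    exact hp.append_right

/-- In postorder the root comes last, directly preceded by its last child, whose subtree fills a
block of known length in front of it. Concatenating blocks shifts positions but keeps the relative
ones. This lets the program find children by subtraction from a table of sizes. -/
theorem childClosed_subs (p : LTL m k) : ChildClosed p.subs := by
  have pair : ∀ p q : LTL m k, (p.subs ++ q.subs)[p.size - 1]? = some p ∧
      (p.subs ++ q.subs)[p.size - 1 + q.size]? = some q := by
    intro p q
    have hp := p.size_pos
    have hq := q.size_pos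
    constructor
    · rw [List.getElem?_append_left (by simp [hp]), getElem?_subs_root]
    · rw [List.getElem?_append_right (by simp; omega), ← q.getElem?_subs_root]
      congr 1
      simp; omega
  induction p with
  | atom a v =>
    exact ChildClosed.snoc (l := []) (fun j p h => by simp at h) trivial
  | neg p ih =>
    have hp := p.size_pos
    exact ih.snoc ⟨p.size - 1, by simp; omega, p.getElem?_subs_root⟩
  | next p ih =>
    have hp := p.size_pos
    exact ih.snoc ⟨p.size - 1, by simp; omega, p.getElem?_subs_root⟩
  | disj p q ihp ihq =>
    have hp := p.size_pos
    exact (ihp.append ihq).snoc ⟨p.size - 1, by simp; omega, pair p q⟩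
  | untl p q ihp ihq =>
    have hp := p.size_pos
    exact (ihp.append ihq).snoc ⟨p.size - 1, by simp; omega, pair p q⟩

end LTL

/-! ### Bad prefixes through infinite words -/

namespace HyperLTL

/-- The outermost binder of the closure is built last, so the induction on `k` splits off the
variable with the largest index, which is bound innermost. -/
theorem sat_univClosure {m : ℕ} (T : Set (Trace m)) : ∀ {k : ℕ} (φ : HyperLTL m k),
    Sat T (univClosure k φ) Fin.elim0 ↔
      ∀ ρ : Fin k → Trace m, (∀ v, ρ v ∈ T) → Sat T φ ρ := by
  intro k
  induction k with
  | zero =>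
    intro φ
    refine ⟨fun h ρ _ => ?_, fun h => h _ (fun v => v.elim0)⟩
    rwa [Subsingleton.elim ρ Fin.elim0]
  | succ k ih =>
    intro φ
    rw [univClosure, ih]
    refine ⟨fun h ρ hρ => ?_, fun h ρ hρ t ht => ?_⟩
    · have := h (Fin.init ρ) (fun v => hρ _) (ρ (Fin.last k)) (hρ _)
      rwa [Fin.snoc_init_self] at this
    · refine h _ fun v => ?_
      refine Fin.lastCases ?_ (fun i => ?_) v
      · simpa using ht
      · simpa using hρ i

theorem models_univ {m k : ℕ} (T : Set (Trace m)) (p : LTL m k) :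
    Models T (univ p) ↔ ∀ ρ : Fin k → Trace m, (∀ v, ρ v ∈ T) → p.Sat ρ :=
  sat_univClosure T (qfree p)

end HyperLTL

/-- The prefix of length `t` of a tuple of traces, as a word of tuples. -/
def Trace.zipPrefix {m k : ℕ} (ρ : Fin k → Trace m) (t : ℕ) : List (Fin k → Letter m) :=
  (List.range t).map fun i v => ρ v i

/-- If an extension `T'` of the components of `w` is a model, choosing one trace of `T'` for each
component gives `ρ`. Conversely the range of `ρ` is a model, because the tuples over a range are the
reindexings `ρ ∘ f`. -/
theorem acceptsOnlyBadPrefixes_iff {m kT kL : ℕ} {Q : Type} (A : DFA (Fin kL → Letter m) Q)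
    (ψ : LTL m kT) : AcceptsOnlyBadPrefixes A (HyperLTL.univ ψ) ↔
      ¬ ∃ ρ : Fin kL → Trace m, (∃ t, Trace.zipPrefix ρ t ∈ A.accepts) ∧
        ∀ f : Fin kT → Fin kL, ψ.Sat fun v => ρ (f v) := by
  have h0 : AcceptsOnlyBadPrefixes A (HyperLTL.univ ψ) ↔
      ∀ w ∈ A.accepts, IsBadPrefix (HyperLTL.univ ψ) (unzip w) := by
    refine forall₂_congr fun w _ => ⟨?_, fun h => ⟨_, h, rfl⟩⟩
    rintro ⟨T, hT, rfl⟩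
    exact hT
  rw [h0]
  constructor
  · rintro h ⟨ρ, ⟨t, ht⟩, hρ⟩
    refine h _ ht (Set.range ρ) ?_ ?_
    · rintro _ ⟨i, rfl⟩
      refine ⟨ρ i, ⟨i, rfl⟩, fun j hj => ?_⟩
      simp [Trace.zipPrefix]
    · rw [HyperLTL.models_univ]
      intro τ hτ
      choose f hf using hτ
      have : τ = fun v => ρ (f v) := funext fun v => (hf v).symm
      rw [this]
      exact hρ f
  · intro h w hw T' hT' hM
    rw [HyperLTL.models_univ] at hM
    have h1 : ∀ i : Fin kL, ∃ t' ∈ T', IsTracePrefix (w.map fun v => v i) t' :=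
      fun i => hT' _ ⟨i, rfl⟩
    choose ρ hρ hp using h1
    refine h ⟨ρ, ⟨w.length, ?_⟩, fun f => hM _ fun v => hρ (f v)⟩
    convert hw
    refine List.ext_getElem (by simp [Trace.zipPrefix]) fun j h1 h2 => ?_
    simp only [Trace.zipPrefix, List.getElem_map, List.getElem_range]
    funext v
    have := hp v j (by simpa using h2)
    simpa using this.symm

/-! ### Fair infinite paths in finite graphs -/

section Walk

variable {α : Type*} {E : α → α → Prop}

theorem exists_path_of_transGen {x y : α} (h : Relation.TransGen E x y) :
    ∃ (l : ℕ) (g : ℕ → α), 0 < l ∧ g 0 = x ∧ g l = y ∧ ∀ i < l, E (g i) (g (i + 1)) := by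
  induction h with
  | @single b h =>
    refine ⟨1, fun i => if i = 0 then x else b, by omega, by simp, by simp, fun i hi => ?_⟩
    obtain rfl : i = 0 := by omega
    simpa using h
  | @tail b c _ h ih =>
    obtain ⟨l, g, hl, h0, h1, hg⟩ := ih
    refine ⟨l + 1, fun i => if i ≤ l then g i else c, by omega, by simpa using h0, by simp, ?_⟩
    intro i hi
    rcases Nat.lt_or_ge i l with h' | h'
    · simpa [h'.le, Nat.succ_le_of_lt h'] using hg i h'
    · obtain rfl : i = l := by omega
      simpa [h1] using h

theorem transGen_of_path {g : ℕ → α} {i j : ℕ} (hij : i < j)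
    (hg : ∀ a, i ≤ a → a < j → E (g a) (g (a + 1))) : Relation.TransGen E (g i) (g j) := by
  induction j with
  | zero => omega
  | succ j ih =>
    rcases Nat.lt_or_ge i j with h | h
    · exact (ih h fun a h1 h2 => hg a h1 (by omega)).tail (hg j h.le (by omega))
    · obtain rfl : i = j := by omega
      exact .single (hg i le_rfl (by omega))

/-- Two consecutive finite paths. -/
theorem exists_path_append {l l' : ℕ} {g g' : ℕ → α} (h : g l = g' 0)
    (hg : ∀ i < l, E (g i) (g (i + 1))) (hg' : ∀ i < l', E (g' i) (g' (i + 1))) :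
    ∃ G : ℕ → α, (∀ i ≤ l, G i = g i) ∧ (∀ i, G (l + i) = g' i) ∧
      ∀ i < l + l', E (G i) (G (i + 1)) := by
  refine ⟨fun i => if i ≤ l then g i else g' (i - l), fun i hi => by simp [hi], fun i => ?_, ?_⟩
  · rcases Nat.eq_zero_or_pos i with rfl | hi
    · simp [h]
    · simp [show ¬ i = 0 by omega]
  · intro i hi
    rcases lt_trichotomy i l with h' | rfl | h'
    · simpa [h'.le, Nat.succ_le_of_lt h'] using hg i h'
    · simpa [h] using hg' 0 (by omega)
    · simp only [if_neg (show ¬ i ≤ l by omega), if_neg (show ¬ i + 1 ≤ l by omega)]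
      rw [show i + 1 - l = i - l + 1 by omega]
      exact hg' _ (by omega)

/-- Start with any closed path at `y` and append, for each condition, a detour from `y` to a node
satisfying it and back. -/
theorem exists_fair_cycle {ι : Type*} {F : ι → α → Prop} {y : α} (hy : Relation.TransGen E y y)
    (hF : ∀ c, ∃ w, Relation.TransGen E y w ∧ Relation.TransGen E w y ∧ F c w) (s : Finset ι) :
    ∃ (l : ℕ) (g : ℕ → α), 0 < l ∧ g 0 = y ∧ g l = y ∧ (∀ i < l, E (g i) (g (i + 1))) ∧
      ∀ c ∈ s, ∃ i < l, F c (g i) := by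
  classical
  induction s using Finset.induction_on with
  | empty =>
    obtain ⟨l, g, h0, h1, h2, h3⟩ := exists_path_of_transGen hy
    exact ⟨l, g, h0, h1, h2, h3, by simp⟩
  | insert c s _ ih =>
    obtain ⟨l, g, hl, h0, h1, hg, hs⟩ := ih
    obtain ⟨w, hw1, hw2, hw⟩ := hF c
    obtain ⟨l1, g1, hl1, h10, h11, hg1⟩ := exists_path_of_transGen hw1
    obtain ⟨l2, g2, hl2, h20, h21, hg2⟩ := exists_path_of_transGen hw2
    obtain ⟨G, hG1, hG2, hG⟩ := exists_path_append (h11.trans h20.symm) hg1 hg2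
    obtain ⟨H, hH1, hH2, hH⟩ := exists_path_append (g := g) (g' := G)
      (by rw [h1, hG1 0 (by omega), h10]) hg hG
    refine ⟨l + (l1 + l2), H, by omega, ?_, ?_, hH, ?_⟩
    · rw [hH1 0 (by omega), h0]
    · rw [hH2, hG2, h21]
    · intro d hd
      rcases Finset.mem_insert.1 hd with rfl | hd
      · refine ⟨l + l1, by omega, ?_⟩
        rw [hH2, hG1 l1 le_rfl, h11]
        exact hw
      · obtain ⟨i, hi, hi'⟩ := hs d hd
        exact ⟨i, by omega, by rwa [hH1 i hi.le]⟩

/-- Given a fair path, pigeonhole yields a node `y` visited infinitely often, and every fairness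
witness lies between two later visits. Given the reachability data, run to `z`, on to `y`, and then
around a cycle through all conditions forever. The alternative `x = z` is needed since `P` may hold
at the start, while `TransGen` stands for nonempty paths. -/
theorem exists_fair_path_iff [Finite α] {ι : Type*} [Finite ι] {F : ι → α → Prop}
    {P : α → Prop} {x : α} :
    (∃ g : ℕ → α, g 0 = x ∧ (∀ i, E (g i) (g (i + 1))) ∧ (∃ i, P (g i)) ∧
      ∀ c i, ∃ j, i ≤ j ∧ F c (g j)) ↔
    ∃ z, (x = z ∨ Relation.TransGen E x z) ∧ P z ∧ ∃ y, Relation.TransGen E z y ∧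
      Relation.TransGen E y y ∧
      ∀ c, ∃ w, Relation.TransGen E y w ∧ Relation.TransGen E w y ∧ F c w := by
  constructor
  · rintro ⟨g, h0, hg, ⟨i, hi⟩, hF⟩
    have tg : ∀ {a b}, a < b → Relation.TransGen E (g a) (g b) := fun hab =>
      transGen_of_path hab fun a _ _ => hg a
    obtain ⟨y, hy⟩ := Finite.exists_infinite_fiber g
    have hinf : (g ⁻¹' {y}).Infinite := Set.infinite_coe_iff.1 hy
    have next : ∀ a, ∃ b, a < b ∧ g b = y := fun a => by
      obtain ⟨b, hb, hab⟩ := hinf.exists_gt a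
      exact ⟨b, hab, hb⟩
    refine ⟨g i, ?_, hi, y, ?_⟩
    · rcases Nat.eq_zero_or_pos i with rfl | h
      · exact Or.inl h0.symm
      · exact Or.inr (h0 ▸ tg h)
    · obtain ⟨a, ha, hay⟩ := next i
      obtain ⟨b, hb, hby⟩ := next a
      refine ⟨hay ▸ tg ha, ?_, fun c => ?_⟩
      · have := tg hb
        rwa [hay, hby] at this
      · obtain ⟨j, hj, hcj⟩ := hF c (a + 1)
        obtain ⟨d, hd, hdy⟩ := next j
        exact ⟨g j, hay ▸ tg (by omega), hdy ▸ tg hd, hcj⟩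
  · rintro ⟨z, hxz, hz, y, hzy, hyy, hF⟩
    classical
    have := Fintype.ofFinite ι
    obtain ⟨L, cyc, hL, hc0, hcL, hcyc, hfair⟩ := exists_fair_cycle hyy hF Finset.univ
    -- The transient part of the lasso. Since the path from `z` to `y` is nonempty, `P` is met
    -- strictly before time `a`, where the cycle takes over.
    have hpre : ∃ (a : ℕ) (p : ℕ → α), 0 < a ∧ p 0 = x ∧ p a = y ∧
        (∀ i < a, E (p i) (p (i + 1))) ∧ ∃ i < a, P (p i) := by
      obtain ⟨l2, g2, hl2, h20, h21, hg2⟩ := exists_path_of_transGen hzy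
      rcases hxz with rfl | hxz
      · exact ⟨l2, g2, hl2, h20, h21, hg2, 0, hl2, by rwa [h20]⟩
      · obtain ⟨l1, g1, hl1, h10, h11, hg1⟩ := exists_path_of_transGen hxz
        obtain ⟨G, hG1, hG2, hG⟩ := exists_path_append (h11.trans h20.symm) hg1 hg2
        refine ⟨l1 + l2, G, by omega, ?_, by rw [hG2, h21], hG, l1, by omega, ?_⟩
        · rw [hG1 0 (by omega), h10]
        · rwa [hG1 l1 le_rfl, h11]
    obtain ⟨a, p, ha, hp0, hpa, hp, i, hi, hPi⟩ := hpre
    refine ⟨fun i => if i < a then p i else cyc ((i - a) % L), by simp [ha, hp0], ?_,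
      ⟨i, by simpa [hi] using hPi⟩, ?_⟩
    · intro i
      rcases Nat.lt_or_ge (i + 1) a with h | h
      · simpa [h, show i < a by omega] using hp i (by omega)
      rcases Nat.lt_or_ge i a with h' | h'
      · obtain rfl : a = i + 1 := by omega
        simpa [hc0, ← hpa] using hp i h'
      · simp only [if_neg (show ¬ i < a by omega), if_neg (show ¬ i + 1 < a by omega)]
        have hlt := Nat.mod_lt (i - a) hL
        have := hcyc _ hlt
        rw [show i + 1 - a = i - a + 1 by omega, Nat.add_mod]
        rcases Nat.lt_or_ge ((i - a) % L + 1) L with h2 | h2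
        · rw [Nat.mod_eq_of_lt (a := 1) (by omega), Nat.mod_eq_of_lt h2]
          exact this
        · have e : (i - a) % L + 1 = L := by omega
          rw [e, hcL] at this
          rw [show ((i - a) % L + 1 % L) % L = 0 by
            rw [Nat.add_mod_mod, e, Nat.mod_self], hc0]
          exact this
    · intro c i
      obtain ⟨j, hj, hcj⟩ := hfair c (Finset.mem_univ c)
      -- Offset `j` within the `i`-th round of the cycle; this is at least `i` because `L` is
      -- positive.
      refine ⟨a + (L * i + j), ?_, ?_⟩
      · nlinarith
      · simp only [if_neg (show ¬ a + (L * i + j) < a by omega), Nat.add_sub_cancel_left,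
          Nat.mul_add_mod, Nat.mod_eq_of_lt hj]
        exact hcj

end Walk

/-! ### The tableau of a formula as a finite graph -/

namespace Tableau

variable {m kT kL n : ℕ}

theorem mul_add_inj {N a b c d : ℕ} (hb : b < N) (hd : d < N) (h : a * N + b = c * N + d) :
    a = c ∧ b = d := by
  have h1 := congrArg (· / N) h
  have h2 := congrArg (· % N) h
  simp only [mul_comm _ N, Nat.mul_add_div (by omega : 0 < N), Nat.mul_add_mod,
    Nat.div_eq_of_lt hb, Nat.div_eq_of_lt hd, Nat.mod_eq_of_lt hb, Nat.mod_eq_of_lt hd] at h1 h2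
  exact ⟨by omega, h2⟩

theorem mul_add_lt {N K a b : ℕ} (ha : a < K) (hb : b < N) : a * N + b < K * N := by
  calc a * N + b < (a + 1) * N := by rw [add_mul]; omega
    _ ≤ K * N := Nat.mul_le_mul_right _ ha

/-- The number of bits of a node that describe a letter and a truth assignment. -/
def width (ψ : LTL m kT) (kL : ℕ) : ℕ := m * kL + kL ^ kT * ψ.size

/-- The number of nodes, which consist of a state, a letter and a truth assignment. -/
def nodes (ψ : LTL m kT) (kL n : ℕ) : ℕ := n * 2 ^ width ψ kL

/-- The truth value assigned by the node `x` to the subformula with position `j` under the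
assignment with number `f` of components to trace variables. -/
def Holds (ψ : LTL m kT) (kL x f j : ℕ) : Prop :=
  x.testBit (m * kL + (f * ψ.size + j)) = true

/-- The component assigned by `f` to the variable `v`. -/
def digit (kL f v : ℕ) : ℕ := f / kL ^ v % kL

/-- The local consistency condition for a node `x` and its successor `y`. -/
def Consistent (ψ : LTL m kT) (kL x y f j : ℕ) : Prop :=
  match ψ.subs[j]? with
  | none => True
  | some (.atom a v) => Holds ψ kL x f j ↔ x.testBit (digit kL f v * m + a) = true
  | some (.neg _) => Holds ψ kL x f j ↔ ¬ Holds ψ kL x f (j - 1)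
  | some (.disj _ q) => Holds ψ kL x f j ↔
      Holds ψ kL x f (j - 1 - q.size) ∨ Holds ψ kL x f (j - 1)
  | some (.next _) => Holds ψ kL x f j ↔ Holds ψ kL y f (j - 1)
  | some (.untl _ q) => Holds ψ kL x f j ↔
      Holds ψ kL x f (j - 1) ∨ (Holds ψ kL x f (j - 1 - q.size) ∧ Holds ψ kL y f j)

/-- The node `x` does not leave an until formula at position `j` pending. -/
def Fulfilled (ψ : LTL m kT) (kL f j x : ℕ) : Prop :=
  ∀ p q, ψ.subs[j]? = some (.untl p q) → ¬ Holds ψ kL x f j ∨ Holds ψ kL x f (j - 1)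

/-- The state of the automaton in a node. -/
def state (ψ : LTL m kT) (kL : ℕ) (x : Fin (nodes ψ kL n)) : Fin n :=
  ⟨x / 2 ^ width ψ kL, Nat.div_lt_of_lt_mul (by rw [mul_comm]; exact x.2)⟩

/-- The edges of the graph. -/
def Edge (ψ : LTL m kT) (A : DFA (Fin kL → Letter m) (Fin n)) (x y : Fin (nodes ψ kL n)) : Prop :=
  A.step (state ψ kL x) (letterOfNat m kL x) = state ψ kL y ∧
    ∀ f < kL ^ kT, ∀ j < ψ.size, Consistent ψ kL x y f j

/-- The initial nodes. -/
def Initial (ψ : LTL m kT) (A : DFA (Fin kL → Letter m) (Fin n)) (x : Fin (nodes ψ kL n)) : Prop :=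
  state ψ kL x = A.start ∧ ∀ f < kL ^ kT, Holds ψ kL x f (ψ.size - 1)

theorem exists_node (ψ : LTL m kT) (kL : ℕ) (q : Fin n) (B : ℕ → Prop) :
    ∃ x : Fin (nodes ψ kL n), state ψ kL x = q ∧
      ∀ i < width ψ kL, ((x : ℕ).testBit i = true ↔ B i) := by
  classical
  set l := width ψ kL with hl
  let b := Nat.ofBits fun i : Fin l => decide (B i)
  have hb : b < 2 ^ l := Nat.ofBits_lt_two_pow _
  have hx : (q : ℕ) * 2 ^ l + b < nodes ψ kL n := mul_add_lt q.2 hb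
  refine ⟨⟨q * 2 ^ l + b, hx⟩, ?_, fun i hi => ?_⟩
  · ext
    simp only [state]
    rw [← hl, mul_comm, Nat.mul_add_div (by positivity), Nat.div_eq_of_lt hb, add_zero]
  · simp only
    rw [mul_comm, Nat.testBit_two_pow_mul_add _ hb, if_pos hi, Nat.testBit_ofBits_lt _ _ hi]
    simp

/-- The function with number `f`. -/
def decode (f : Fin (kL ^ kT)) : Fin kT → Fin kL := finFunctionFinEquiv.symm f

/-- `finFunctionFinEquiv` encodes functions by base-`kL` digits, which is what the machine extracts
by division and remainder. -/
theorem decode_val (f : Fin (kL ^ kT)) (v : Fin kT) : (decode f v : ℕ) = digit kL f v := rfl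

theorem suffix_suffix (t : Trace m) (i j : ℕ) : (t.suffix i).suffix j = t.suffix (i + j) := by
  funext l
  simp [Trace.suffix, add_assoc]

/-- The unfolding of the until operator. -/
theorem sat_untl_iff {k : ℕ} (p q : LTL m k) (ρ : Fin k → Trace m) :
    (LTL.untl p q).Sat ρ ↔ q.Sat ρ ∨ (p.Sat ρ ∧ (LTL.untl p q).Sat fun v => (ρ v).suffix 1) := by
  have h0 : (fun v => (ρ v).suffix 0) = ρ := by funext v l; simp [Trace.suffix]
  simp only [LTL.Sat, suffix_suffix]
  constructor
  · rintro ⟨i, hq, hp⟩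
    rcases i with _ | i
    · left; rwa [h0] at hq
    · right
      refine ⟨by have := hp 0 (by omega); rwa [h0] at this, i, by rwa [add_comm], fun j hj => ?_⟩
      have := hp (j + 1) (by omega)
      rwa [add_comm 1]
  · rintro (h | ⟨hp0, i, hq, hp⟩)
    · exact ⟨0, by rwa [h0], fun j hj => by omega⟩
    · refine ⟨i + 1, by rwa [add_comm], fun j hj => ?_⟩
      rcases j with _ | j
      · rwa [h0]
      · have := hp j (by omega)
        rwa [add_comm 1] at this

theorem suffix_succ {k : ℕ} (ρ : Fin k → Trace m) (i : ℕ) :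
    (fun v => ((fun w => (ρ w).suffix i) v).suffix 1) = fun v => (ρ v).suffix (i + 1) := by
  funext v
  exact suffix_suffix _ _ _

/-- Along a fair path, the nodes assign the actual truth values. -/
theorem holds_iff_sat {ψ : LTL m kT} {g : ℕ → ℕ} {ρ : Fin kL → Trace m}
    (hρ : ∀ i v (a : Fin m), a ∈ ρ v i ↔ (g i).testBit (v * m + a) = true)
    (hg : ∀ i, ∀ f < kL ^ kT, ∀ j < ψ.size, Consistent ψ kL (g i) (g (i + 1)) f j)
    (hf : ∀ f < kL ^ kT, ∀ j < ψ.size, ∀ i, ∃ i', i ≤ i' ∧ Fulfilled ψ kL f j (g i'))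
    (f : Fin (kL ^ kT)) (p : LTL m kT) : ∀ j, ψ.subs[j]? = some p → ∀ i,
      (Holds ψ kL (g i) f j ↔ p.Sat fun v => (ρ (decode f v)).suffix i) := by
  have hlt : ∀ {j p}, ψ.subs[j]? = some p → j < ψ.size := fun {j p} h => by
    simpa using (List.getElem?_eq_some_iff.1 h).1
  induction p with
  | atom a v =>
    intro j hj i
    have := hg i f f.2 j (hlt hj)
    simp only [Consistent, hj] at this
    rw [this, ← decode_val, ← hρ]
    simp [LTL.Sat, Trace.suffix]
  | neg p ih =>
    intro j hj i
    obtain ⟨i', rfl, hp⟩ := ψ.childClosed_subs j _ hj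
    have := hg i f f.2 _ (hlt hj)
    simp only [Consistent, hj, Nat.add_sub_cancel] at this
    rw [this, ih i' hp]
    rfl
  | next p ih =>
    intro j hj i
    obtain ⟨i', rfl, hp⟩ := ψ.childClosed_subs j _ hj
    have := hg i f f.2 _ (hlt hj)
    simp only [Consistent, hj, Nat.add_sub_cancel] at this
    rw [this, ih i' hp, LTL.Sat, suffix_succ]
  | disj p q ihp ihq =>
    intro j hj i
    obtain ⟨i', rfl, hp, hq⟩ := ψ.childClosed_subs j _ hj
    have := hg i f f.2 _ (hlt hj)
    simp only [Consistent, hj, Nat.add_sub_cancel] at this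
    rw [this, ihp i' hp, ihq _ hq]
    rfl
  | untl p q ihp ihq =>
    intro j hj i
    obtain ⟨i', hj', hp, hq⟩ := ψ.childClosed_subs j _ hj
    subst hj'
    have hloc : ∀ i, Holds ψ kL (g i) f (i' + q.size + 1) ↔
        (q.Sat fun v => (ρ (decode f v)).suffix i) ∨
        ((p.Sat fun v => (ρ (decode f v)).suffix i) ∧
          Holds ψ kL (g (i + 1)) f (i' + q.size + 1)) := by
      intro i
      have := hg i f f.2 _ (hlt hj)
      simp only [Consistent, hj, Nat.add_sub_cancel] at this
      rw [this, ihp i' hp, ihq _ hq]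
    have hsat : ∀ i, ((LTL.untl p q).Sat fun v => (ρ (decode f v)).suffix i) ↔
        (q.Sat fun v => (ρ (decode f v)).suffix i) ∨
        ((p.Sat fun v => (ρ (decode f v)).suffix i) ∧
          (LTL.untl p q).Sat fun v => (ρ (decode f v)).suffix (i + 1)) := by
      intro i
      rw [sat_untl_iff, suffix_succ (fun v => ρ (decode f v))]
    constructor
    · intro h
      -- The unfolding law alone would also allow an until that is claimed forever and never
      -- fulfilled. Fairness gives a time `b ≥ i` at which the claim is dropped or `q` holds; the
      -- proof is by induction on the distance to `b`.
      obtain ⟨b, hb, hful⟩ := hf f f.2 _ (hlt hj) i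
      replace hful := hful p q hj
      rw [Nat.add_sub_cancel, ihq _ hq] at hful
      obtain ⟨d, rfl⟩ := Nat.exists_eq_add_of_le hb
      clear hb
      induction d generalizing i with
      | zero =>
        rw [hsat]
        left
        exact hful.resolve_left (fun h' => h' h)
      | succ d ih =>
        rw [hsat]
        refine ((hloc i).1 h).imp_right fun h' => ⟨h'.1, ih (i + 1) h'.2 ?_⟩
        rwa [show i + 1 + d = i + (d + 1) by omega]
    · intro h
      simp only [LTL.Sat, suffix_suffix] at h
      obtain ⟨d, hq', hp'⟩ := h
      induction d generalizing i with
      | zero => exact (hloc i).2 (Or.inl hq')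
      | succ d ih =>
        refine (hloc i).2 (Or.inr ⟨hp' 0 (by omega), ih (i + 1) ?_ fun l hl => ?_⟩)
        · rwa [show i + 1 + d = i + (d + 1) by omega]
        · have := hp' (l + 1) (by omega)
          rwa [show i + 1 + l = i + (l + 1) by omega]

/-- The actual truth values of an infinite word are locally consistent. -/
theorem consistent_of_sat {ψ : LTL m kT} {x y i : ℕ} {ρ : Fin kL → Trace m}
    (hx : ∀ (v : Fin kL) (a : Fin m), x.testBit (v * m + a) = true ↔ a ∈ ρ v i)
    (f : Fin (kL ^ kT))
    (hx' : ∀ j p, ψ.subs[j]? = some p →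
      (Holds ψ kL x f j ↔ p.Sat fun v => (ρ (decode f v)).suffix i))
    (hy' : ∀ j p, ψ.subs[j]? = some p →
      (Holds ψ kL y f j ↔ p.Sat fun v => (ρ (decode f v)).suffix (i + 1))) (j : ℕ) :
    Consistent ψ kL x y f j := by
  simp only [Consistent]
  rcases hj : ψ.subs[j]? with _ | ⟨a, v⟩ | p | ⟨p, q⟩ | p | ⟨p, q⟩
  · trivial
  · simp only
    rw [hx' _ _ hj, ← decode_val, hx]
    simp [LTL.Sat, Trace.suffix]
  · obtain ⟨i', rfl, hp⟩ := ψ.childClosed_subs j _ hj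
    simp only [Nat.add_sub_cancel]
    rw [hx' _ _ hj, hx' _ _ hp]
    rfl
  · obtain ⟨i', rfl, hp, hq⟩ := ψ.childClosed_subs j _ hj
    simp only [Nat.add_sub_cancel]
    rw [hx' _ _ hj, hx' _ _ hp, hx' _ _ hq]
    rfl
  · obtain ⟨i', rfl, hp⟩ := ψ.childClosed_subs j _ hj
    simp only [Nat.add_sub_cancel]
    rw [hx' _ _ hj, hy' _ _ hp, LTL.Sat, suffix_succ]
  · obtain ⟨i', hj', hp, hq⟩ := ψ.childClosed_subs j _ hj
    subst hj'
    simp only [Nat.add_sub_cancel]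
    rw [hx' _ _ hj, hx' _ _ hp, hx' _ _ hq, hy' _ _ hj, sat_untl_iff,
      suffix_succ (fun v => ρ (decode f v))]

/-- The fairness conditions along the actual truth values of an infinite word. -/
theorem exists_fulfilled_of_sat {ψ : LTL m kT} {g : ℕ → ℕ} {ρ : Fin kL → Trace m}
    (f : Fin (kL ^ kT))
    (hg : ∀ i j p, ψ.subs[j]? = some p →
      (Holds ψ kL (g i) f j ↔ p.Sat fun v => (ρ (decode f v)).suffix i)) (j i : ℕ) :
    ∃ i', i ≤ i' ∧ Fulfilled ψ kL f j (g i') := by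
  by_contra! hcon
  have h0 := hcon i le_rfl
  simp only [Fulfilled, not_forall, not_or, not_not] at h0
  obtain ⟨p, q, hj, h1, -⟩ := h0
  rw [hg _ _ _ hj] at h1
  simp only [LTL.Sat, suffix_suffix] at h1
  obtain ⟨d, hd, -⟩ := h1
  obtain ⟨i', hj', hp, hq⟩ := ψ.childClosed_subs j _ hj
  subst hj'
  -- An until pending at `i` is true there, so its right argument holds at some time `i + d`, where
  -- it is no longer pending.
  refine hcon (i + d) (by omega) fun _ _ _ => Or.inr ?_
  rw [Nat.add_sub_cancel]
  obtain ⟨hlt, -⟩ := List.getElem?_eq_some_iff.1 hq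
  exact (hg _ _ _ hq).2 hd

theorem evalFrom_map_range {σ Q : Type*} (A : DFA σ Q) (q : ℕ → Q) (a : ℕ → σ)
    (h : ∀ i, A.step (q i) (a i) = q (i + 1)) (t : ℕ) :
    A.evalFrom (q 0) ((List.range t).map a) = q t := by
  induction t with
  | zero => rfl
  | succ t ih => rw [List.range_succ, List.map_append, DFA.evalFrom_of_append, ih]; exact h t

/-- The node that describes a position of an infinite word. -/
theorem exists_node_of_word (ψ : LTL m kT) (q : Fin n) (ρ : Fin kL → Trace m) (i : ℕ) :
    ∃ x : Fin (nodes ψ kL n), state ψ kL x = q ∧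
      (∀ (v : Fin kL) (a : Fin m), (x : ℕ).testBit (v * m + a) = true ↔ a ∈ ρ v i) ∧
      ∀ (f : Fin (kL ^ kT)) j p, ψ.subs[j]? = some p →
        (Holds ψ kL x f j ↔ p.Sat fun v => (ρ (decode f v)).suffix i) := by
  -- The bits of the letter occupy positions below `m * kL`, those of the truth assignment the
  -- positions above; the disjuncts are disjoint and each index determines its data by
  -- `mul_add_inj`.
  obtain ⟨x, hx, hB⟩ := exists_node ψ kL q fun l =>
    (∃ (v : Fin kL) (a : Fin m), l = v * m + a ∧ a ∈ ρ v i) ∨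
    ∃ (f : Fin (kL ^ kT)) (j : ℕ) (p : LTL m kT), l = m * kL + (f * ψ.size + j) ∧
      ψ.subs[j]? = some p ∧ p.Sat fun v => (ρ (decode f v)).suffix i
  have hltA : ∀ (v : Fin kL) (a : Fin m), (v : ℕ) * m + a < m * kL := fun v a => by
    rw [mul_comm m]; exact mul_add_lt v.2 a.2
  have hltS : ∀ {j p}, ψ.subs[j]? = some p → j < ψ.size := fun {j p} h => by
    simpa using (List.getElem?_eq_some_iff.1 h).1
  refine ⟨x, hx, fun v a => ?_, fun f j p hj => ?_⟩
  · rw [hB _ ((hltA v a).trans_le (Nat.le_add_right _ _))]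
    constructor
    · rintro (⟨v', a', h, h'⟩ | ⟨f, j, p, h, -⟩)
      · obtain ⟨h1, h2⟩ := mul_add_inj a.2 a'.2 h
        rwa [Fin.ext h1, Fin.ext h2]
      · have := hltA v a
        omega
    · exact fun h => Or.inl ⟨v, a, rfl, h⟩
  · rw [Holds, hB _ (Nat.add_lt_add_left (mul_add_lt f.2 (hltS hj)) _)]
    constructor
    · rintro (⟨v, a, h, -⟩ | ⟨f', j', p', h, hj', hp'⟩)
      · have := hltA v a
        omega
      · obtain ⟨h1, h2⟩ := mul_add_inj (hltS hj) (hltS hj') (Nat.add_left_cancel h)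
        obtain rfl := Fin.ext h1
        subst h2
        rw [hj] at hj'
        cases hj'
        exact hp'
    · exact fun h => Or.inr ⟨f, j, p, rfl, hj, h⟩

/-- Satisfying extensions of accepted words correspond to fair paths. -/
theorem exists_word_iff (ψ : LTL m kT) (A : DFA (Fin kL → Letter m) (Fin n)) :
    (∃ ρ : Fin kL → Trace m, (∃ t, Trace.zipPrefix ρ t ∈ A.accepts) ∧
      ∀ f : Fin kT → Fin kL, ψ.Sat fun v => ρ (f v)) ↔
    ∃ x, Initial ψ A x ∧ ∃ g : ℕ → Fin (nodes ψ kL n), g 0 = x ∧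
      (∀ i, Edge ψ A (g i) (g (i + 1))) ∧ (∃ i, state ψ kL (g i) ∈ A.accept) ∧
      ∀ (c : Fin (kL ^ kT) × Fin ψ.size) i, ∃ j, i ≤ j ∧ Fulfilled ψ kL c.1 c.2 (g j) := by
  have suffix_zero : ∀ f : Fin kT → Trace m, (fun v => (f v).suffix 0) = f := fun f => by
    funext v l
    simp [Trace.suffix]
  constructor
  · rintro ⟨ρ, ⟨t, ht⟩, hρ⟩
    -- The node at time `i` carries the state reached after `i` letters and the `i`-th letter still
    -- to be read, so accepting states mark accepted prefixes.
    let q : ℕ → Fin n := fun i => A.evalFrom A.start (Trace.zipPrefix ρ i)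
    have hq : ∀ i, A.step (q i) (fun v => ρ v i) = q (i + 1) := by
      intro i
      simp only [q, Trace.zipPrefix]
      rw [List.range_succ, List.map_append, DFA.evalFrom_of_append]
      rfl
    choose g hgq hgl hgs using fun i => exists_node_of_word ψ (q i) ρ i
    refine ⟨g 0, ⟨hgq 0, fun f hf => ?_⟩, g, rfl, fun i => ⟨?_, fun f hf j _ => ?_⟩, ⟨t, ?_⟩,
      fun c i => ?_⟩
    · rw [hgs 0 ⟨f, hf⟩ _ _ ψ.getElem?_subs_root, suffix_zero fun v => ρ (decode ⟨f, hf⟩ v)]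
      exact hρ _
    · rw [hgq, hgq, ← hq]
      congr 1
      funext v
      ext a
      exact hgl i v a
    · exact consistent_of_sat (hgl i) ⟨f, hf⟩ (hgs i ⟨f, hf⟩) (hgs (i + 1) ⟨f, hf⟩) j
    · rw [hgq]
      exact ht
    · exact exists_fulfilled_of_sat (g := fun i => (g i : ℕ)) c.1 (fun i => hgs i c.1) c.2 i
  · rintro ⟨x, ⟨hx, hx'⟩, g, rfl, hg, ⟨t, ht⟩, hf⟩
    let ρ : Fin kL → Trace m := fun v i => letterOfNat m kL (g i) v
    refine ⟨ρ, ⟨t, ?_⟩, fun f => ?_⟩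
    · have := evalFrom_map_range A (fun i => state ψ kL (g i)) (fun i v => ρ v i)
        (fun i => (hg i).1) t
      simp only [hx] at this
      change A.evalFrom _ _ ∈ A.accept
      rw [Trace.zipPrefix, this]
      exact ht
    · have := holds_iff_sat (g := fun i => (g i : ℕ)) (ρ := ρ) (fun i v a => Iff.rfl)
        (fun i => (hg i).2) (fun f hf' j hj i => hf (⟨f, hf'⟩, ⟨j, hj⟩) i)
        (finFunctionFinEquiv f) ψ _ ψ.getElem?_subs_root 0
      have := this.1 (hx' _ (finFunctionFinEquiv f).2)
      rw [suffix_zero fun v => ρ (decode (finFunctionFinEquiv f) v)] at this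
      simpa [decode] using this

/-- The graph criterion. -/
theorem acceptsOnlyBadPrefixes_iff_graph (ψ : LTL m kT) (A : DFA (Fin kL → Letter m) (Fin n)) :
    AcceptsOnlyBadPrefixes A (HyperLTL.univ ψ) ↔
    ¬ ∃ x, Initial ψ A x ∧ ∃ z, (x = z ∨ Relation.TransGen (Edge ψ A) x z) ∧
      state ψ kL z ∈ A.accept ∧ ∃ y, Relation.TransGen (Edge ψ A) z y ∧
      Relation.TransGen (Edge ψ A) y y ∧ ∀ c : Fin (kL ^ kT) × Fin ψ.size,
        ∃ w, Relation.TransGen (Edge ψ A) y w ∧ Relation.TransGen (Edge ψ A) w y ∧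
          Fulfilled ψ kL c.1 c.2 w := by
  rw [acceptsOnlyBadPrefixes_iff, exists_word_iff]
  refine not_congr (exists_congr fun x => and_congr_right fun _ => ?_)
  exact exists_fair_path_iff (E := Edge ψ A) (P := fun z => state ψ kL z ∈ A.accept)
    (F := fun (c : Fin (kL ^ kT) × Fin ψ.size) w => Fulfilled ψ kL c.1 c.2 w)

end Tableau

/-! ### Arithmetic and bounded quantifiers in the term language -/

namespace RAM.Tm

/-- The term in a context with one more variable. -/
def up (t : Tm) : Tm := drop 0 t

def not (t : Tm) : Tm := ite t (const 0) (const 1)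

def and (t u : Tm) : Tm := ite t u (const 0)

def or (t u : Tm) : Tm := ite t (const 1) u

def iff (t u : Tm) : Tm := ite t u u.not

def lt (t u : Tm) : Tm := monus u t

def le (t u : Tm) : Tm := not (monus t u)

def eq (t u : Tm) : Tm := not (plus (monus t u) (monus u t))

/-- The product. -/
def mul (t u : Tm) : Tm :=
  iter (const 0) (ite (lt (var 0) t.up.up) (plus (var 1) u.up.up) (var 1))

/-- The power. -/
def pow (t u : Tm) : Tm :=
  iter (const 1) (ite (lt (var 0) u.up.up) (mul t.up.up (var 1)) (var 1))

/-- The quotient. -/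
def div (t u : Tm) : Tm :=
  iter (const 0) (ite (le (mul (plus (var 1) (const 1)) u.up.up) t.up.up)
    (plus (var 1) (const 1)) (var 1))

/-- The remainder. -/
def mod (t u : Tm) : Tm := monus t (mul (div t u) u)

/-- A binary digit. -/
def bit (t u : Tm) : Tm := mod (div t (pow (const 2) u)) (const 2)

/-- Bounded universal quantification. -/
def all (b t : Tm) : Tm :=
  iter (const 1) (ite (drop 1 (lt (var 0) b.up)) (ite (drop 1 t) (var 1) (const 0)) (var 1))

/-- Bounded existential quantification. -/
def ex (b t : Tm) : Tm :=
  iter (const 0) (ite (drop 1 (lt (var 0) b.up)) (ite (drop 1 t) (const 1) (var 1)) (var 1))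

/-- The term is nonzero. -/
def IsTrue (s : Store) (e : List ℕ) (t : Tm) : Prop := t.eval s e ≠ 0

variable {s : Store} {e : List ℕ} {t u b : Tm} {i x y : ℕ}

@[simp] theorem eval_const : (const x).eval s e = x := rfl

@[simp] theorem eval_var_zero : (var 0).eval s (x :: e) = x := rfl

@[simp] theorem eval_var_one : (var 1).eval s (x :: y :: e) = y := rfl

@[simp] theorem eval_up : t.up.eval s (x :: e) = t.eval s e := rfl

@[simp] theorem eval_plus : (plus t u).eval s e = t.eval s e + u.eval s e := rfl

@[simp] theorem eval_monus : (monus t u).eval s e = t.eval s e - u.eval s e := rfl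

@[simp] theorem eval_read_one : (read 1 t).eval s e = s 1 (t.eval s e) := rfl
@[simp] theorem eval_read_two : (read 2 t).eval s e = s 2 (t.eval s e) := rfl
@[simp] theorem eval_read_three : (read 3 t).eval s e = s 3 (t.eval s e) := rfl
@[simp] theorem eval_read_four : (read 4 t).eval s e = s 4 (t.eval s e) := rfl
@[simp] theorem eval_read_five : (read 5 t).eval s e = s 5 (t.eval s e) := rfl
@[simp] theorem eval_read_ten : (read 10 t).eval s e = s 10 (t.eval s e) := rfl

theorem eval_ite_pos (h : IsTrue s e b) : (ite b t u).eval s e = t.eval s e := if_pos h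

theorem eval_ite_neg (h : ¬ IsTrue s e b) : (ite b t u).eval s e = u.eval s e := if_neg h

theorem isTrue_ite : IsTrue s e (ite b t u) ↔
    (IsTrue s e b ∧ IsTrue s e t) ∨ (¬ IsTrue s e b ∧ IsTrue s e u) := by
  by_cases h : IsTrue s e b
  · simp only [h, true_and, not_true_eq_false, false_and, or_false]
    rw [IsTrue, eval_ite_pos h, IsTrue]
  · simp only [h, not_false_eq_true, true_and, false_and, false_or]
    rw [IsTrue, eval_ite_neg h, IsTrue]

@[simp] theorem isTrue_const : IsTrue s e (const x) ↔ x ≠ 0 := Iff.rfl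

@[simp] theorem isTrue_not : IsTrue s e t.not ↔ ¬ IsTrue s e t := by simp [not, isTrue_ite]

@[simp] theorem isTrue_and : IsTrue s e (t.and u) ↔ IsTrue s e t ∧ IsTrue s e u := by
  simp [and, isTrue_ite]

@[simp] theorem isTrue_or : IsTrue s e (t.or u) ↔ IsTrue s e t ∨ IsTrue s e u := by
  simp only [or, isTrue_ite, isTrue_const]; tauto

@[simp] theorem isTrue_iff : IsTrue s e (t.iff u) ↔ (IsTrue s e t ↔ IsTrue s e u) := by
  simp only [iff, isTrue_ite, isTrue_not]; tauto

@[simp] theorem isTrue_lt : IsTrue s e (t.lt u) ↔ t.eval s e < u.eval s e := by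
  simp [lt, IsTrue]; omega

@[simp] theorem isTrue_le : IsTrue s e (t.le u) ↔ t.eval s e ≤ u.eval s e := by
  rw [le, isTrue_not, IsTrue, eval_monus]; omega

@[simp] theorem isTrue_eq : IsTrue s e (t.eq u) ↔ t.eval s e = u.eval s e := by
  rw [eq, isTrue_not, IsTrue, eval_plus, eval_monus, eval_monus]; omega

/-- The invariant rule for loops. As a loop always runs `s.cap` times, the arithmetic below uses
invariants with `min i _`, which become stationary once the intended count is reached. -/
theorem eval_iter_induction (I : ℕ → ℕ → Prop) (h0 : I 0 (t.eval s e))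
    (hs : ∀ i < s.cap, ∀ x, I i x → I (i + 1) (u.eval s (i :: x :: e))) :
    I s.cap ((iter t u).eval s e) := by
  have : ∀ n ≤ s.cap, I n (Nat.rec (t.eval s e) (fun i x => u.eval s (i :: x :: e)) n) := by
    intro n
    induction n with
    | zero => intro _; exact h0
    | succ n ih => intro hn; exact hs n hn _ (ih (by omega))
  exact this _ le_rfl

/-- Repeated addition, counted by the first factor. Only that factor has to be at most the cap; the
second factor and the product may exceed it. -/
theorem eval_mul (h : t.eval s e ≤ s.cap) : (t.mul u).eval s e = t.eval s e * u.eval s e := by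
  have := eval_iter_induction (s := s) (e := e) (t := const 0)
    (u := ite (lt (var 0) t.up.up) (plus (var 1) u.up.up) (var 1))
    (fun i x => x = min i (t.eval s e) * u.eval s e) (by simp) ?_
  · rwa [min_eq_right h] at this
  · intro i hi x hx
    rcases Nat.lt_or_ge i (t.eval s e) with hlt | hlt
    · rw [eval_ite_pos (by simpa using hlt), eval_plus, eval_up, eval_up, eval_var_one, hx,
        min_eq_left hlt.le, min_eq_left hlt, add_mul, one_mul]
    · rw [eval_ite_neg (by simpa using hlt), eval_var_one, hx, min_eq_right (by omega),
        min_eq_right (by omega)]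

/-- The accumulated power is the second factor of the inner product and hence unrestricted, so a
power may be far larger than the cap. This is what allows the cap to grow exponentially from one
phase to the next. -/
theorem eval_pow (ht : t.eval s e ≤ s.cap) (hu : u.eval s e ≤ s.cap) :
    (t.pow u).eval s e = t.eval s e ^ u.eval s e := by
  have := eval_iter_induction (s := s) (e := e) (t := const 1)
    (u := ite (lt (var 0) u.up.up) (mul t.up.up (var 1)) (var 1))
    (fun i x => x = t.eval s e ^ min i (u.eval s e)) (by simp) ?_
  · rwa [min_eq_right hu] at this
  · intro i hi x hx
    rcases Nat.lt_or_ge i (u.eval s e) with hlt | hlt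
    · rw [eval_ite_pos (by simpa using hlt), eval_mul (by simpa using ht), eval_up, eval_up,
        eval_var_one, hx, min_eq_left hlt.le, min_eq_left hlt, pow_succ']
    · rw [eval_ite_neg (by simpa using hlt), eval_var_one, hx, min_eq_right (by omega),
        min_eq_right (by omega)]

/-- The candidate is increased while its successor still fits. After `i` rounds it is at most `i`,
so its successor is an admissible first factor of `mul`. -/
theorem eval_div (ht : t.eval s e ≤ s.cap) (hu : 0 < u.eval s e) :
    (t.div u).eval s e = t.eval s e / u.eval s e := by
  have := eval_iter_induction (s := s) (e := e) (t := const 0)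
    (u := ite (le (mul (plus (var 1) (const 1)) u.up.up) t.up.up)
      (plus (var 1) (const 1)) (var 1))
    (fun i x => x = min i (t.eval s e / u.eval s e)) (by simp) ?_
  · rwa [min_eq_right ((Nat.div_le_self _ _).trans ht)] at this
  · intro i hi x hx
    have hxi : x ≤ i := hx ▸ min_le_left _ _
    have hc : IsTrue s (i :: x :: e) (le (mul (plus (var 1) (const 1)) u.up.up) t.up.up) ↔
        x + 1 ≤ t.eval s e / u.eval s e := by
      rw [isTrue_le, eval_mul (by simp; omega), Nat.le_div_iff_mul_le hu]
      simp
    by_cases h : x + 1 ≤ t.eval s e / u.eval s e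
    · rw [eval_ite_pos (hc.2 h), eval_plus, eval_var_one, eval_const]
      omega
    · rw [eval_ite_neg fun h' => h (hc.1 h'), eval_var_one]
      omega

theorem eval_mod (ht : t.eval s e ≤ s.cap) (hu : 0 < u.eval s e) :
    (t.mod u).eval s e = t.eval s e % u.eval s e := by
  have h : (t.div u).eval s e ≤ s.cap := by
    rw [eval_div ht hu]; exact (Nat.div_le_self _ _).trans ht
  rw [mod, eval_monus, eval_mul h, eval_div ht hu]
  have := Nat.div_add_mod' (t.eval s e) (u.eval s e)
  omega

theorem isTrue_bit (h2 : 2 ≤ s.cap) (ht : t.eval s e ≤ s.cap) (hu : u.eval s e ≤ s.cap) :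
    IsTrue s e (t.bit u) ↔ (t.eval s e).testBit (u.eval s e) = true := by
  have hp : (pow (const 2) u).eval s e = 2 ^ u.eval s e := eval_pow h2 hu
  have hd : (t.div (pow (const 2) u)).eval s e = t.eval s e / 2 ^ u.eval s e := by
    rw [eval_div ht (by rw [hp]; positivity), hp]
  rw [IsTrue, bit, eval_mod (by rw [hd]; exact (Nat.div_le_self _ _).trans ht) (by simp), hd,
    Nat.testBit_eq_decide_div_mod_eq, eval_const, decide_eq_true_eq]
  omega

theorem isTrue_all (h : b.eval s e ≤ s.cap) :
    IsTrue s e (all b t) ↔ ∀ i < b.eval s e, IsTrue s (i :: e) t := by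
  have := eval_iter_induction (s := s) (e := e) (t := const 1)
    (u := ite (drop 1 (lt (var 0) b.up)) (ite (drop 1 t) (var 1) (const 0)) (var 1))
    (fun i x => x ≠ 0 ↔ ∀ j < i, j < b.eval s e → IsTrue s (j :: e) t) (by simp) ?_
  · rw [IsTrue, all, this]
    exact ⟨fun H i hi => H i (by omega) hi, fun H i _ hi => H i hi⟩
  · intro i hi x hx
    have h1 : IsTrue s (i :: x :: e) (drop 1 (lt (var 0) b.up)) ↔ i < b.eval s e := by
      change IsTrue s (i :: e) (lt (var 0) b.up) ↔ _
      simp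
    -- `drop 1` hides the accumulator, so the body sees only the bound variable and the outer
    -- context, as an ordinary quantifier would have it.
    have h2 : IsTrue s (i :: x :: e) (drop 1 t) ↔ IsTrue s (i :: e) t := Iff.rfl
    change IsTrue s (i :: x :: e) _ ↔ _
    rw [isTrue_ite, isTrue_ite, h1, h2]
    simp only [isTrue_const]
    rw [show IsTrue s (i :: x :: e) (var 1) ↔ _ from hx]
    simp only [Nat.lt_succ_iff_lt_or_eq, or_imp, forall_and, forall_eq]
    by_cases hb : i < b.eval s e <;> by_cases ht : IsTrue s (i :: e) t <;> simp [hb, ht]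

theorem isTrue_ex (h : b.eval s e ≤ s.cap) :
    IsTrue s e (ex b t) ↔ ∃ i < b.eval s e, IsTrue s (i :: e) t := by
  have := eval_iter_induction (s := s) (e := e) (t := const 0)
    (u := ite (drop 1 (lt (var 0) b.up)) (ite (drop 1 t) (const 1) (var 1)) (var 1))
    (fun i x => x ≠ 0 ↔ ∃ j < i, j < b.eval s e ∧ IsTrue s (j :: e) t) (by simp) ?_
  · rw [IsTrue, ex, this]
    exact ⟨fun ⟨i, _, H⟩ => ⟨i, H⟩, fun ⟨i, H, H'⟩ => ⟨i, by omega, H, H'⟩⟩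
  · intro i hi x hx
    have h1 : IsTrue s (i :: x :: e) (drop 1 (lt (var 0) b.up)) ↔ i < b.eval s e := by
      change IsTrue s (i :: e) (lt (var 0) b.up) ↔ _
      simp
    have h2 : IsTrue s (i :: x :: e) (drop 1 t) ↔ IsTrue s (i :: e) t := Iff.rfl
    change IsTrue s (i :: x :: e) _ ↔ _
    rw [isTrue_ite, isTrue_ite, h1, h2]
    simp only [isTrue_const]
    rw [show IsTrue s (i :: x :: e) (var 1) ↔ _ from hx]
    simp only [Nat.lt_succ_iff_lt_or_eq, or_and_right, exists_or, exists_eq_left]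
    by_cases hb : i < b.eval s e <;> by_cases ht : IsTrue s (i :: e) t <;> simp [hb, ht]

end RAM.Tm

/-! ### Transitive closures by dynamic programming -/

/-- The relation of being connected by a path all of whose inner nodes are below `r`. -/
def pathsBelow {V : ℕ} (E : Fin V → Fin V → Prop) : ℕ → Fin V → Fin V → Prop
  | 0, x, y => E x y
  | r + 1, x, y => pathsBelow E r x y ∨
      ∃ h : r < V, pathsBelow E r x ⟨r, h⟩ ∧ pathsBelow E r ⟨r, h⟩ y

theorem transGen_of_pathsBelow {V : ℕ} {E : Fin V → Fin V → Prop} {r : ℕ} {x y : Fin V}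
    (h : pathsBelow E r x y) : Relation.TransGen E x y := by
  induction r generalizing x y with
  | zero => exact .single h
  | succ r ih =>
    rcases h with h | ⟨hr, h1, h2⟩
    · exact ih h
    · exact (ih h1).trans (ih h2)

/-- Induction on `r`. If the middle node is the new node `r` itself, the part of the first path up
to `r` and the part of the second path from `r` on avoid `r` inside. -/
theorem pathsBelow_trans {V : ℕ} {E : Fin V → Fin V → Prop} {r : ℕ} {x y z : Fin V}
    (hy : (y : ℕ) < r) (h1 : pathsBelow E r x y) (h2 : pathsBelow E r y z) :
    pathsBelow E r x z := by
  induction r generalizing x y z with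
  | zero => omega
  | succ r ih =>
    rcases Nat.lt_succ_iff_lt_or_eq.1 hy with hlt | heq
    · rcases h1 with h1 | ⟨hr, h1, h1'⟩ <;> rcases h2 with h2 | ⟨hr', h2, h2'⟩
      · exact Or.inl (ih hlt h1 h2)
      · exact Or.inr ⟨hr', ih hlt h1 h2, h2'⟩
      · exact Or.inr ⟨hr, h1, ih hlt h1' h2⟩
      · exact Or.inr ⟨hr, h1, h2'⟩
    · have hr : r < V := heq ▸ y.2
      obtain rfl : y = ⟨r, hr⟩ := Fin.ext heq
      have h1' : pathsBelow E r x ⟨r, hr⟩ := by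
        rcases h1 with h1 | ⟨_, h1, _⟩ <;> exact h1
      have h2' : pathsBelow E r ⟨r, hr⟩ z := by
        rcases h2 with h2 | ⟨_, _, h2⟩ <;> exact h2
      exact Or.inr ⟨hr, h1', h2'⟩

theorem pathsBelow_iff_transGen {V : ℕ} {E : Fin V → Fin V → Prop} {x y : Fin V} :
    pathsBelow E V x y ↔ Relation.TransGen E x y := by
  refine ⟨transGen_of_pathsBelow, fun h => ?_⟩
  have hmono : ∀ r, ∀ {x y}, E x y → pathsBelow E r x y := by
    intro r
    induction r with
    | zero => exact fun h => h
    | succ r ih => exact fun h => Or.inl (ih h)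
  induction h with
  | single h => exact hmono V h
  | tail _ h ih => exact pathsBelow_trans (Fin.is_lt _) ih (hmono V h)

/-! ### The decision procedure -/

namespace BadPrefix

open RAM RAM.Tm

/-- A parameter of the input. -/
def input (i : ℕ) : Tm := .read 0 (.const i)

/-- A number computed from the parameters of the input. -/
def param (i : ℕ) : Tm := .read 8 (.const i)

/-- Does the node `x` assign true to the subformula at position `j` under assignment `f`? -/
def holds (x f j : Tm) : Tm := x.bit (.plus (param 0) (.plus (mul f (input 3)) j))

/-- The component assigned by `f` to the variable `v`. -/
def digit (f v : Tm) : Tm := mod (div f (pow (input 1) v)) (input 1)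

/-- The predecessor. -/
def pred (j : Tm) : Tm := .monus j (.const 1)

/-- The position of the left child. -/
def left (j : Tm) : Tm := .monus (pred j) (.read 9 (pred j))

/-- Is the node at position `j` of the syntax tree of kind `i`? -/
def kind (j : Tm) (i : ℕ) : Tm := eq (.read 1 j) (.const i)

/-- Local consistency. -/
def consistent (x y f j : Tm) : Tm :=
  .ite (kind j 0)
    ((holds x f j).iff (x.bit (.plus (mul (digit f (.read 3 j)) (input 0)) (.read 2 j)))) <|
  .ite (kind j 1) ((holds x f j).iff (holds x f (pred j)).not) <|
  .ite (kind j 2) ((holds x f j).iff ((holds x f (left j)).or (holds x f (pred j)))) <|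
  .ite (kind j 3) ((holds x f j).iff (holds y f (pred j)))
    ((holds x f j).iff
      ((holds x f (pred j)).or ((holds x f (left j)).and (holds y f j))))

/-- Is the until formula at position `j` not pending? -/
def fulfilled (x f j : Tm) : Tm :=
  (kind j 4).not.or ((holds x f j).not.or (holds x f (pred j)))

/-- The state of a node. -/
def state (x : Tm) : Tm := div x (param 4)

/-- Is there an edge from `x` to `y`? -/
def edge (x y : Tm) : Tm :=
  (eq (.read 5 (.plus (mul (state x) (param 2)) (mod x (param 2)))) (state y)).and <|
  all (param 1) <| all (input 3) <| consistent x.up.up y.up.up (.var 1) (.var 0)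

/-- Is `x` an initial node? -/
def initial (x : Tm) : Tm :=
  (eq (state x) (input 5)).and (all (param 1) (holds x.up (.var 0) (pred (input 3))))

/-- Is `y` reachable from `x` by a nonempty path? -/
def reach (x y : Tm) : Tm := .read 10 (.plus (mul x (param 5)) y)

/-- Is there a fair path? -/
def answer : Tm :=
  ex (param 5) <| (initial (.var 0)).and <|
  ex (param 5) <| ((eq (.var 1) (.var 0)).or (reach (.var 1) (.var 0))).and <|
    (Tm.read 4 (state (.var 0))).and <|
  ex (param 5) <| (reach (.var 1) (.var 0)).and <| (reach (.var 0) (.var 0)).and <|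
  all (param 1) <| all (input 3) <|
  ex (param 5) <| (reach (.var 3) (.var 0)).and <| (reach (.var 0) (.var 3)).and <|
    fulfilled (.var 0) (.var 2) (.var 1)

/-- A letter depends on the lowest `m * k` bits only. A node can thus be used directly as the number
of its letter, and its remainder as the column of the transition table. -/
theorem letterOfNat_mod (m k b : ℕ) : letterOfNat m k (b % 2 ^ (m * k)) =
    letterOfNat m k b := by
  funext i
  ext a
  simp only [letterOfNat, Set.mem_ofPred_eq, Nat.testBit_mod_two_pow]
  have : (i : ℕ) * m + a < m * k := by rw [mul_comm m]; exact Tableau.mul_add_lt i.2 a.2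
  simp [this]

variable {m kT kL n : ℕ} {ψ : LTL m kT} {A : DFA (Fin kL → Letter m) (Fin n)}

/-- The memory contains the input. -/
def HasInput (ψ : LTL m kT) (A : DFA (Fin kL → Letter m) (Fin n)) (s : Store) : Prop :=
  ∀ a < 6, s a = inputStore ψ A a

namespace HasInput

variable {s : Store} {e : List ℕ}

theorem eval_input_zero (h : HasInput ψ A s) : (BadPrefix.input 0).eval s e = m := by
  change s 0 0 = m; rw [h 0 (by omega)]; rfl

theorem eval_input_one (h : HasInput ψ A s) : (BadPrefix.input 1).eval s e = kL := by
  change s 0 1 = kL; rw [h 0 (by omega)]; rfl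

theorem eval_input_two (h : HasInput ψ A s) : (BadPrefix.input 2).eval s e = kT := by
  change s 0 2 = kT; rw [h 0 (by omega)]; rfl

theorem eval_input_three (h : HasInput ψ A s) : (BadPrefix.input 3).eval s e = ψ.size := by
  change s 0 3 = _; rw [h 0 (by omega)]; rfl

theorem eval_input_four (h : HasInput ψ A s) : (BadPrefix.input 4).eval s e = n := by
  change s 0 4 = n; rw [h 0 (by omega)]; rfl

theorem eval_input_five (h : HasInput ψ A s) : (BadPrefix.input 5).eval s e = A.start := by
  change s 0 5 = _; rw [h 0 (by omega)]; rfl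

theorem read_label (h : HasInput ψ A s) {j : ℕ} {p : LTL m kT} (hj : ψ.subs[j]? = some p) :
    s 1 j = p.label.1 ∧ s 2 j = p.label.2.1 ∧ s 3 j = p.label.2.2 := by
  have key : ψ.postorder.getD j (0, 0, 0) = p.label := by
    rw [LTL.postorder_eq, List.getD_eq_getElem?_getD, List.getElem?_map, hj]
    rfl
  rw [h 1 (by omega), h 2 (by omega), h 3 (by omega)]
  simp only [inputStore, key, and_self]

theorem kind_iff (h : HasInput ψ A s)
    {i : ℕ} {j : Tm} {p : LTL m kT} (hj : ψ.subs[j.eval s e]? = some p) :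
    IsTrue s e (kind j i) ↔ p.label.1 = i := by
  rw [kind, isTrue_eq, eval_read_one, (h.read_label hj).1, eval_const]

end HasInput

/-! ### Correctness of the terms describing the graph -/

/-- The memory contains the input, the parameters and the table of sizes. -/
structure Ready (ψ : LTL m kT) (A : DFA (Fin kL → Letter m) (Fin n)) (s : Store) : Prop where
  input : HasInput ψ A s
  letterBits : s 8 0 = m * kL
  assignments : s 8 1 = kL ^ kT
  letters : s 8 2 = 2 ^ (m * kL)
  width : s 8 3 = Tableau.width ψ kL
  labels : s 8 4 = 2 ^ Tableau.width ψ kL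
  nodes : s 8 5 = Tableau.nodes ψ kL n
  pairs : s 8 6 = Tableau.nodes ψ kL n * Tableau.nodes ψ kL n
  sizes : ∀ j p, ψ.subs[j]? = some p → s 9 j = p.size
  cap : s.cap = Tableau.nodes ψ kL n * Tableau.nodes ψ kL n + Tableau.width ψ kL + kL ^ kT +
    (m + kL + kT + ψ.size + n) + 2

namespace Ready

variable {s : Store}

/-- Array `10` holds the table of pairs of nodes, the only array changed while edges and closure are
computed. -/
theorem congr (h : Ready ψ A s) {s' : Store} (hs : ∀ a, a ≠ 10 → s' a = s a) : Ready ψ A s' where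
  input a ha := by rw [hs a (by omega), h.input a ha]
  letterBits := by rw [hs 8 (by omega), h.letterBits]
  assignments := by rw [hs 8 (by omega), h.assignments]
  letters := by rw [hs 8 (by omega), h.letters]
  width := by rw [hs 8 (by omega), h.width]
  labels := by rw [hs 8 (by omega), h.labels]
  nodes := by rw [hs 8 (by omega), h.nodes]
  pairs := by rw [hs 8 (by omega), h.pairs]
  sizes j p hj := by rw [hs 9 (by omega), h.sizes j p hj]
  cap := by
    change s' 7 0 = _
    rw [hs 7 (by omega)]
    exact h.cap

theorem nodes_le_cap (h : Ready ψ A s) : Tableau.nodes ψ kL n ≤ s.cap := by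
  rw [h.cap]
  have := Nat.le_mul_self (Tableau.nodes ψ kL n)
  omega

variable {e : List ℕ} {x y f j : Tm}

theorem holds_iff (h : Ready ψ A s)
    (hx : x.eval s e < Tableau.nodes ψ kL n) (hf : f.eval s e < kL ^ kT)
    (hj : j.eval s e < ψ.size) : IsTrue s e (holds x f j) ↔
      Tableau.Holds ψ kL (x.eval s e) (f.eval s e) (j.eval s e) := by
  have hi : m * kL + (f.eval s e * ψ.size + j.eval s e) < Tableau.width ψ kL :=
    Nat.add_lt_add_left (Tableau.mul_add_lt hf hj) _
  have hN := h.nodes_le_cap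
  have hcap := h.cap
  have he : (Tm.plus (param 0) (.plus (mul f (BadPrefix.input 3)) j)).eval s e =
      m * kL + (f.eval s e * ψ.size + j.eval s e) := by
    rw [eval_plus, eval_plus, eval_mul (by omega), h.input.eval_input_three]
    congr 1
    exact h.letterBits
  rw [holds, isTrue_bit (by omega) (by omega) (by rw [he]; omega), he, Tableau.Holds]

theorem eval_digit (h : Ready ψ A s) {v : Tm} (hf : f.eval s e < kL ^ kT) (hv : v.eval s e < kT) :
    (digit f v).eval s e = Tableau.digit kL (f.eval s e) (v.eval s e) := by
  -- With `kL = 0` and a variable `v < kT` there is no assignment at all, contradicting `hf`.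
  have hL : 0 < kL := by
    rcases Nat.eq_zero_or_pos kL with rfl | h'
    · rw [zero_pow (by omega)] at hf; omega
    · exact h'
  have hcap := h.cap
  have hp : (pow (BadPrefix.input 1) v).eval s e = kL ^ v.eval s e := by
    rw [eval_pow (by rw [h.input.eval_input_one]; omega) (by omega), h.input.eval_input_one]
  have hd : (div f (pow (BadPrefix.input 1) v)).eval s e = f.eval s e / kL ^ v.eval s e := by
    rw [eval_div (by omega) (by rw [hp]; positivity), hp]
  have hle := Nat.div_le_self (f.eval s e) (kL ^ v.eval s e)
  rw [digit, eval_mod (by rw [hd]; omega) (by rwa [h.input.eval_input_one]), hd,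
    h.input.eval_input_one, Tableau.digit]

theorem consistent_iff (h : Ready ψ A s) (hx : x.eval s e < Tableau.nodes ψ kL n)
    (hy : y.eval s e < Tableau.nodes ψ kL n) (hf : f.eval s e < kL ^ kT)
    (hj : j.eval s e < ψ.size) : IsTrue s e (consistent x y f j) ↔
      Tableau.Consistent ψ kL (x.eval s e) (y.eval s e) (f.eval s e) (j.eval s e) := by
  have hsome : ∃ p, ψ.subs[j.eval s e]? = some p :=
    ⟨_, List.getElem?_eq_getElem (by simpa using hj)⟩
  obtain ⟨p, hp⟩ := hsome
  have hlt : ∀ {i p}, ψ.subs[i]? = some p → i < ψ.size := fun {i p} h => by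
    simpa using (List.getElem?_eq_some_iff.1 h).1
  have hpred : (pred j).eval s e = j.eval s e - 1 := rfl
  -- Truncated subtraction keeps both candidate child positions in range for every kind of node, so
  -- all branches of the case distinction can be translated before the kind is known.
  have hpred' : (pred j).eval s e < ψ.size := by omega
  have hleft : (left j).eval s e = j.eval s e - 1 - s 9 (j.eval s e - 1) := rfl
  have hleft' : (left j).eval s e < ψ.size := by omega
  have hN := h.nodes_le_cap
  have hcap := h.cap
  have hch := ψ.childClosed_subs _ _ hp
  simp only [consistent, isTrue_ite, h.input.kind_iff hp, isTrue_iff, isTrue_not, isTrue_or,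
    isTrue_and, h.holds_iff hx hf hj, h.holds_iff hy hf hj, h.holds_iff hx hf hpred', h.holds_iff hy hf hpred',
    h.holds_iff hx hf hleft', Tableau.Consistent, hp]
  rcases p with ⟨a, v⟩ | p | ⟨p, q⟩ | p | ⟨p, q⟩
  · obtain ⟨-, h2, h3⟩ := h.input.read_label hp
    have hd : (digit f (.read 3 j)).eval s e = Tableau.digit kL (f.eval s e) v := by
      rw [h.eval_digit hf (by rw [eval_read_three, h3]; exact v.2), eval_read_three, h3]
      rfl
    have hdl : Tableau.digit kL (f.eval s e) v < kL := by
      rw [← Tableau.decode_val ⟨_, hf⟩ v]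
      exact (Tableau.decode _ v).2
    have hm : Tableau.digit kL (f.eval s e) v * m + a < m * kL := by
      rw [mul_comm m]; exact Tableau.mul_add_lt hdl a.2
    have hw : m * kL ≤ Tableau.width ψ kL := Nat.le_add_right _ _
    have he : (Tm.plus (mul (digit f (.read 3 j)) (BadPrefix.input 0)) (.read 2 j)).eval s e =
        Tableau.digit kL (f.eval s e) v * m + a := by
      rw [eval_plus, eval_mul (by rw [hd]; omega), hd, h.input.eval_input_zero, eval_read_two, h2]
      rfl
    rw [isTrue_bit (by omega) (by omega) (by rw [he]; omega), he]
    simp [LTL.label]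
  · simp [LTL.label, hpred]
  · obtain ⟨i, hi, hi1, hi2⟩ := hch
    have : s 9 (j.eval s e - 1) = q.size := h.sizes _ _ (by rw [hi]; exact hi2)
    simp [LTL.label, hpred, hleft, this]
  · simp [LTL.label, hpred]
  · obtain ⟨i, hi, hi1, hi2⟩ := hch
    have : s 9 (j.eval s e - 1) = q.size := h.sizes _ _ (by rw [hi]; exact hi2)
    simp [LTL.label, hpred, hleft, this]

theorem fulfilled_iff (h : Ready ψ A s)
    (hx : x.eval s e < Tableau.nodes ψ kL n) (hf : f.eval s e < kL ^ kT)
    (hj : j.eval s e < ψ.size) : IsTrue s e (fulfilled x f j) ↔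
      Tableau.Fulfilled ψ kL (f.eval s e) (j.eval s e) (x.eval s e) := by
  obtain ⟨p, hp⟩ : ∃ p, ψ.subs[j.eval s e]? = some p :=
    ⟨_, List.getElem?_eq_getElem (by simpa using hj)⟩
  have hpred : (pred j).eval s e = j.eval s e - 1 := rfl
  have hpred' : (pred j).eval s e < ψ.size := by omega
  simp only [fulfilled, isTrue_not, isTrue_or, h.input.kind_iff hp, h.holds_iff hx hf hj,
    h.holds_iff hx hf hpred', hpred, Tableau.Fulfilled, hp]
  rcases p with ⟨a, v⟩ | p | ⟨p, q⟩ | p | ⟨p, q⟩ <;> simp [LTL.label]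

theorem eval_state (h : Ready ψ A s) (hx : x.eval s e < Tableau.nodes ψ kL n) :
    (BadPrefix.state x).eval s e = x.eval s e / 2 ^ Tableau.width ψ kL := by
  have hN := h.nodes_le_cap
  have hp : (param 4).eval s e = 2 ^ Tableau.width ψ kL := h.labels
  rw [BadPrefix.state, eval_div (by omega) (by rw [hp]; positivity), hp]

theorem eval_state_fin (h : Ready ψ A s) (hx : x.eval s e < Tableau.nodes ψ kL n) :
    (BadPrefix.state x).eval s e = Tableau.state ψ kL ⟨x.eval s e, hx⟩ := h.eval_state hx

theorem edge_iff (h : Ready ψ A s) (hx : x.eval s e < Tableau.nodes ψ kL n)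
    (hy : y.eval s e < Tableau.nodes ψ kL n) : IsTrue s e (edge x y) ↔
      Tableau.Edge ψ A ⟨x.eval s e, hx⟩ ⟨y.eval s e, hy⟩ := by
  have hN := h.nodes_le_cap
  have hcap := h.cap
  have h1 : ∀ {e}, (param 1).eval s e = kL ^ kT := h.assignments
  have h2 : (param 2).eval s e = 2 ^ (m * kL) := h.letters
  have hstep : (Tm.read 5 (.plus (mul (BadPrefix.state x) (param 2)) (mod x (param 2)))).eval s e =
      A.step (Tableau.state ψ kL ⟨x.eval s e, hx⟩) (letterOfNat m kL (x.eval s e)) := by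
    have hle := Nat.div_le_self (x.eval s e) (2 ^ Tableau.width ψ kL)
    rw [eval_read_five, eval_plus, eval_mul (by rw [h.eval_state hx]; omega),
      eval_mod (by omega) (by rw [h2]; positivity), h2, h.eval_state_fin hx, h.input 5 (by omega)]
    have hpos : 0 < 2 ^ (m * kL) := by positivity
    have hdiv : ((Tableau.state ψ kL ⟨x.eval s e, hx⟩ : ℕ) * 2 ^ (m * kL) +
        x.eval s e % 2 ^ (m * kL)) / 2 ^ (m * kL) = Tableau.state ψ kL ⟨x.eval s e, hx⟩ := by
      rw [mul_comm, Nat.mul_add_div hpos, Nat.div_eq_of_lt (Nat.mod_lt _ hpos), add_zero]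
    have hmod : ((Tableau.state ψ kL ⟨x.eval s e, hx⟩ : ℕ) * 2 ^ (m * kL) +
        x.eval s e % 2 ^ (m * kL)) % 2 ^ (m * kL) = x.eval s e % 2 ^ (m * kL) := by
      rw [mul_comm, Nat.mul_add_mod, Nat.mod_mod]
    simp only [inputStore, hdiv, hmod, Fin.is_lt, dite_true, Fin.eta, letterOfNat_mod]
  have hst : (BadPrefix.state y).eval s e = Tableau.state ψ kL ⟨y.eval s e, hy⟩ := h.eval_state hy
  rw [edge, isTrue_and, isTrue_eq, hstep, hst, Tableau.Edge, Fin.ext_iff,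
    isTrue_all (by rw [h1]; omega), h1]
  refine and_congr_right fun _ => forall₂_congr fun f hf => ?_
  rw [isTrue_all (by rw [h.input.eval_input_three]; omega), h.input.eval_input_three]
  refine forall₂_congr fun j hj => ?_
  rw [h.consistent_iff (by simpa using hx) (by simpa using hy) (by simpa using hf)
    (by simpa using hj)]
  simp

theorem initial_iff (h : Ready ψ A s)
    (hx : x.eval s e < Tableau.nodes ψ kL n) : IsTrue s e (initial x) ↔
    Tableau.Initial ψ A ⟨x.eval s e, hx⟩ := by
  have hcap := h.cap
  have h1 : ∀ {e}, (param 1).eval s e = kL ^ kT := h.assignments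
  have hp : ∀ {e}, (pred (BadPrefix.input 3)).eval s e = ψ.size - 1 := by
    intro e
    rw [pred, eval_monus, h.input.eval_input_three, eval_const]
  have := ψ.size_pos
  rw [initial, isTrue_and, isTrue_eq, h.eval_state_fin hx, h.input.eval_input_five, Tableau.Initial,
    Fin.ext_iff, isTrue_all (by rw [h1]; omega), h1]
  refine and_congr_right fun _ => forall₂_congr fun f hf => ?_
  rw [h.holds_iff (by simpa using hx) (by simpa using hf) (by rw [hp]; omega), hp]
  simp

theorem reach_iff (h : Ready ψ A s)
    {R : Fin (Tableau.nodes ψ kL n) → Fin (Tableau.nodes ψ kL n) → Prop}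
    (hR : ∀ x y : Fin (Tableau.nodes ψ kL n), s 10 (x * Tableau.nodes ψ kL n + y) ≠ 0 ↔ R x y)
    (hx : x.eval s e < Tableau.nodes ψ kL n) (hy : y.eval s e < Tableau.nodes ψ kL n) :
    IsTrue s e (reach x y) ↔ R ⟨x.eval s e, hx⟩ ⟨y.eval s e, hy⟩ := by
  have hN := h.nodes_le_cap
  have h5 : (param 5).eval s e = Tableau.nodes ψ kL n := h.nodes
  rw [reach, IsTrue, eval_read_ten, eval_plus, eval_mul (by omega), h5, ← hR]

theorem accept_iff (h : Ready ψ A s) (hx : x.eval s e < Tableau.nodes ψ kL n) :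
    IsTrue s e (.read 4 (BadPrefix.state x)) ↔
      Tableau.state ψ kL ⟨x.eval s e, hx⟩ ∈ A.accept := by
  rw [IsTrue, eval_read_four, h.eval_state_fin hx, h.input 4 (by omega)]
  simp [inputStore]

/-- The term transcribes the graph criterion, with the quantifiers over nodes, assignments and
positions bounded by numbers below the cap and reachability looked up in array `10`. -/
theorem answer_iff (h : Ready ψ A s)
    (hR : ∀ x y : Fin (Tableau.nodes ψ kL n), s 10 (x * Tableau.nodes ψ kL n + y) ≠ 0 ↔
      Relation.TransGen (Tableau.Edge ψ A) x y) :
    IsTrue s [] answer ↔ ¬ AcceptsOnlyBadPrefixes A (HyperLTL.univ ψ) := by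
  have hN := h.nodes_le_cap
  have hcap := h.cap
  have h5 : ∀ {e}, (param 5).eval s e = Tableau.nodes ψ kL n := h.nodes
  have h1 : ∀ {e}, (param 1).eval s e = kL ^ kT := h.assignments
  have hex : ∀ {e : List ℕ} {t : Tm} {P : Fin (Tableau.nodes ψ kL n) → Prop},
      (∀ x : Fin (Tableau.nodes ψ kL n), IsTrue s (x :: e) t ↔ P x) →
      (IsTrue s e (ex (param 5) t) ↔ ∃ x, P x) := by
    intro e t P hP
    rw [isTrue_ex (by rw [h5]; omega), h5]
    simp only [Fin.exists_iff, ← hP]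
    exact ⟨fun ⟨i, hi, H⟩ => ⟨i, hi, H⟩, fun ⟨i, hi, H⟩ => ⟨i, hi, H⟩⟩
  rw [Tableau.acceptsOnlyBadPrefixes_iff_graph, not_not, answer]
  have hreach : ∀ {e : List ℕ} {t u : Tm} {x y : Fin (Tableau.nodes ψ kL n)},
      t.eval s e = x → u.eval s e = y →
      (IsTrue s e (reach t u) ↔ Relation.TransGen (Tableau.Edge ψ A) x y) := by
    intro e t u x y hx hy
    rw [h.reach_iff hR (by rw [hx]; exact x.2) (by rw [hy]; exact y.2)]
    simp only [hx, hy]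
  refine hex fun x => isTrue_and.trans (and_congr
    (h.initial_iff (x := .var 0) (e := [(x : ℕ)]) x.2) (hex fun z =>
    isTrue_and.trans (and_congr (isTrue_or.trans
      (or_congr (isTrue_eq.trans Fin.ext_iff.symm) (hreach (by rfl) (by rfl))))
    (isTrue_and.trans (and_congr (h.accept_iff (x := .var 0) (e := [(z : ℕ), (x : ℕ)]) z.2)
    (hex fun y => isTrue_and.trans (and_congr (hreach (by rfl) (by rfl))
      (isTrue_and.trans (and_congr (hreach (by rfl) (by rfl)) ?_)))))))))
  rw [isTrue_all (by rw [h1]; omega), h1, Prod.forall, Fin.forall_iff]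
  refine forall₂_congr fun f hf => ?_
  rw [isTrue_all (by rw [h.input.eval_input_three]; omega), h.input.eval_input_three,
    Fin.forall_iff]
  refine forall₂_congr fun j hj => hex fun w =>
    isTrue_and.trans (and_congr (hreach (by rfl) (by rfl))
    (isTrue_and.trans (and_congr (hreach (by rfl) (by rfl)) ?_)))
  -- The innermost context is `[w, j, f, y, z, x]`, which explains the variables `2` and `1` here
  -- and variable `3` for `y`.
  exact h.fulfilled_iff (x := .var 0) (f := .var 2) (j := .var 1)
    (e := [(w : ℕ), j, f, (y : ℕ), (z : ℕ), (x : ℕ)]) w.2 hf hj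

end Ready

end BadPrefix

/-! ### The programs filling the tables -/

namespace BadPrefix

open RAM RAM.Tm

/-- The size of the subformula at position `j`, computed from the sizes at smaller positions. -/
def size (j : Tm) : Tm :=
  .ite (kind j 0) (.const 1) <|
  .ite ((kind j 1).or (kind j 3)) (.plus (.read 9 (pred j)) (.const 1))
    (.plus (.plus (.read 9 (left j)) (.read 9 (pred j))) (.const 1))

/-- The sum of the parameters of the input. -/
def inputSum : Tm :=
  .plus (.plus (.plus (.plus (input 0) (input 1)) (input 2)) (input 3)) (input 4)

/-- The table of sizes. -/
def sizesStmt : Stmt :=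
  .all (.guard (lt (.var 0) (input 3)) (.set 9 (.var 0) (size (.var 0))))

/-- The numbers of bits and assignments, and the sizes of the subformulas. -/
def widthPhase : Phase where
  bound := inputSum
  body := .seq (.set 8 (.const 0) (mul (input 0) (input 1))) <|
    .seq (.set 8 (.const 1) (pow (input 1) (input 2))) <|
    .seq (.set 8 (.const 3) (.plus (param 0) (mul (input 3) (param 1)))) sizesStmt

/-- The number of nodes. -/
def nodesPhase : Phase where
  bound := .plus (.plus (param 3) (input 4)) (.const 2)
  body := .seq (.set 8 (.const 2) (pow (.const 2) (param 0))) <|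
    .seq (.set 8 (.const 4) (pow (.const 2) (param 3))) <|
    .set 8 (.const 5) (mul (input 4) (param 4))

/-- The number of pairs of nodes. -/
def pairsPhase : Phase where
  bound := param 5
  body := .set 8 (.const 6) (mul (param 5) (param 5))

/-- The table of edges. -/
def edgesStmt : Stmt :=
  .all (.guard (lt (.var 0) (param 6)) (.set 10 (.var 0)
    (edge (div (.var 0) (param 5)) (mod (.var 0) (param 5)))))

/-- The transitive closure of the table of edges. -/
def closureStmt : Stmt :=
  .all (.guard (lt (.var 0) (param 5)) (.all (.guard (lt (.var 0) (param 6)) (.set 10 (.var 0)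
    ((Tm.read 10 (.var 0)).or
      ((reach (div (.var 0) (param 5)) (.var 1)).and
        (reach (.var 1) (mod (.var 0) (param 5)))))))))

/-- The search for a fair path. -/
def graphPhase : Phase where
  bound := .plus (.plus (.plus (.plus (param 6) (param 3)) (param 1)) inputSum) (.const 2)
  body := .seq edgesStmt (.seq closureStmt (.set 0 (.const 0) answer.not))

/-- The decision procedure. -/
def phases : List Phase := [widthPhase, nodesPhase, pairsPhase, graphPhase]

theorem exec_set {a : ℕ} (ha : a ≠ 6) (ha' : a ≠ 7) (i v : Tm) (e : List ℕ) (s : Store) :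
    (Stmt.set a i v).exec e s = s.set a (i.eval s e) (v.eval s e) := by
  simp [Stmt.exec, ha, ha']

theorem exec_guard_pos {c : Tm} {e : List ℕ} {s : Store} (h : IsTrue s e c) (p : Stmt) :
    (Stmt.guard c p).exec e s = p.exec e s := if_pos h

theorem exec_guard_neg {c : Tm} {e : List ℕ} {s : Store} (h : ¬ IsTrue s e c) (p : Stmt) :
    (Stmt.guard c p).exec e s = s := if_neg h

theorem cap_set {a : ℕ} (ha : a ≠ 7) (s : Store) (i x : ℕ) : (s.set a i x).cap = s.cap := by
  simp only [Store.cap, Store.set_of_ne s ha.symm]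

variable {m kT kL n : ℕ} {ψ : LTL m kT} {A : DFA (Fin kL → Letter m) (Fin n)}

theorem HasInput.set {s : Store} (h : HasInput ψ A s) {a : ℕ} (ha : 6 ≤ a) (i x : ℕ) :
    HasInput ψ A (s.set a i x) := fun b hb => by
  rw [Store.set_of_ne s (by omega), h b hb]

theorem HasInput.eval_inputSum {s : Store} {e : List ℕ} (h : HasInput ψ A s) :
    inputSum.eval s e = m + kL + kT + ψ.size + n := by
  simp only [inputSum, eval_plus, h.eval_input_zero, h.eval_input_one, h.eval_input_two,
    h.eval_input_three, h.eval_input_four]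

theorem HasInput.eval_size {s : Store} {e : List ℕ} {j : Tm} (h : HasInput ψ A s) {p : LTL m kT}
    (hp : ψ.subs[j.eval s e]? = some p)
    (hs : ∀ i < j.eval s e, ∀ q, ψ.subs[i]? = some q → s 9 i = q.size) :
    (size j).eval s e = p.size := by
  have hch := ψ.childClosed_subs _ _ hp
  have hk : ∀ i, IsTrue s e (kind j i) ↔ p.label.1 = i := fun i => h.kind_iff hp
  have h9 : ∀ {j : Tm}, (Tm.read 9 (pred j)).eval s e = s 9 (j.eval s e - 1) := rfl
  have h9' : (Tm.read 9 (left j)).eval s e = s 9 (j.eval s e - 1 - s 9 (j.eval s e - 1)) := rfl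
  rcases p with ⟨a, v⟩ | p | ⟨p, q⟩ | p | ⟨p, q⟩
  · rw [size, eval_ite_pos ((hk 0).2 rfl)]
    rfl
  · obtain ⟨i, hi, hi'⟩ := hch
    rw [size, eval_ite_neg (by rw [hk]; simp [LTL.label]),
      eval_ite_pos (by rw [isTrue_or, hk, hk]; simp [LTL.label]), eval_plus, h9, hi,
      Nat.add_sub_cancel, hs i (by omega) _ hi']
    rfl
  · obtain ⟨i, hi, hi1, hi2⟩ := hch
    rw [size, eval_ite_neg (by rw [hk]; simp [LTL.label]),
      eval_ite_neg (by rw [isTrue_or, hk, hk]; simp [LTL.label]), eval_plus, eval_plus, h9, h9', hi,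
      Nat.add_sub_cancel, hs (i + q.size) (by omega) _ hi2, Nat.add_sub_cancel,
      hs i (by omega) _ hi1]
    rfl
  · obtain ⟨i, hi, hi'⟩ := hch
    rw [size, eval_ite_neg (by rw [hk]; simp [LTL.label]),
      eval_ite_pos (by rw [isTrue_or, hk, hk]; simp [LTL.label]), eval_plus, h9, hi,
      Nat.add_sub_cancel, hs i (by omega) _ hi']
    rfl
  · obtain ⟨i, hi, hi1, hi2⟩ := hch
    rw [size, eval_ite_neg (by rw [hk]; simp [LTL.label]),
      eval_ite_neg (by rw [isTrue_or, hk, hk]; simp [LTL.label]), eval_plus, eval_plus, h9, h9', hi,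
      Nat.add_sub_cancel, hs (i + q.size) (by omega) _ hi2, Nat.add_sub_cancel,
      hs i (by omega) _ hi1]
    rfl

/-- In postorder children precede their parent, so one pass from left to right finds the sizes of
the children already stored. -/
theorem HasInput.exec_sizesStmt {s : Store} (h : HasInput ψ A s) (hcap : ψ.size ≤ s.cap) :
    (∀ a, a ≠ 9 → sizesStmt.exec [] s a = s a) ∧
      ∀ j p, ψ.subs[j]? = some p → sizesStmt.exec [] s 9 j = p.size := by
  have hlt : ∀ {i p}, ψ.subs[i]? = some p → i < ψ.size := fun {i p} h => by
    simpa using (List.getElem?_eq_some_iff.1 h).1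
  have := Stmt.all_induction (e := []) (s := s)
    (p := .guard (lt (.var 0) (input 3)) (.set 9 (.var 0) (size (.var 0))))
    (fun i s' => (∀ a, a ≠ 9 → s' a = s a) ∧
      ∀ j < i, ∀ p, ψ.subs[j]? = some p → s' 9 j = p.size)
    ⟨fun _ _ => rfl, fun j hj => by omega⟩ ?_
  · exact ⟨this.1, fun j p hp => this.2 j ((hlt hp).trans_le hcap) p hp⟩
  · rintro i - s' ⟨h1, h2⟩
    have hin : HasInput ψ A s' := fun a ha => by rw [h1 a (by omega), h a ha]
    by_cases hi : i < ψ.size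
    · rw [exec_guard_pos (by rw [isTrue_lt, hin.eval_input_three]; exact hi),
        exec_set (by omega) (by omega)]
      refine ⟨fun a ha => by rw [Store.set_of_ne _ ha, h1 a ha], fun j hj p hp => ?_⟩
      rw [Store.set_apply, eval_var_zero]
      rcases Nat.lt_succ_iff_lt_or_eq.1 hj with hj | rfl
      · rw [if_neg (by omega)]
        exact h2 j hj p hp
      · rw [if_pos ⟨rfl, rfl⟩]
        exact hin.eval_size (by exact hp) (by exact h2)
    · rw [exec_guard_neg (by rw [isTrue_lt, hin.eval_input_three]; exact hi)]
      refine ⟨h1, fun j hj p hp => ?_⟩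
      exact h2 j (by have := hlt hp; omega) p hp

namespace Ready

variable {s : Store}

theorem isTrue_lt_pairs (h : Ready ψ A s)
    {s' : Store} (hs : ∀ a, a ≠ 10 → s' a = s a) (i : ℕ) (e : List ℕ) :
    IsTrue s' (i :: e) (lt (.var 0) (param 6)) ↔
      i < Tableau.nodes ψ kL n * Tableau.nodes ψ kL n := by
  have h6 : (param 6).eval s' (i :: e) = _ := (h.congr hs).pairs
  rw [isTrue_lt, h6]
  exact Iff.rfl

theorem eval_div_nodes (h : Ready ψ A s)
    {s' : Store} (hs : ∀ a, a ≠ 10 → s' a = s a) {i : ℕ} {e : List ℕ}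
    (hi : i < Tableau.nodes ψ kL n * Tableau.nodes ψ kL n) :
    (div (.var 0) (param 5)).eval s' (i :: e) = i / Tableau.nodes ψ kL n ∧
    (mod (.var 0) (param 5)).eval s' (i :: e) = i % Tableau.nodes ψ kL n := by
  have hpos := Nat.pos_of_mul_pos_left (by omega : 0 < Tableau.nodes ψ kL n * Tableau.nodes ψ kL n)
  have h5 : (param 5).eval s' (i :: e) = _ := (h.congr hs).nodes
  have hcap := (h.congr hs).cap
  rw [eval_div (by rw [eval_var_zero]; omega) (by rw [h5]; exact hpos),
    eval_mod (by rw [eval_var_zero]; omega) (by rw [h5]; exact hpos), h5, eval_var_zero]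
  exact ⟨rfl, rfl⟩

/-- The pair `(x, y)` is stored at index `x * N + y`, `N` being the number of nodes; after `i`
rounds the entries below `i` are correct. Further rounds, up to the cap, are skipped by the guard.
-/
theorem exec_edgesStmt (h : Ready ψ A s) : (∀ a, a ≠ 10 → edgesStmt.exec [] s a = s a) ∧
    ∀ x y : Fin (Tableau.nodes ψ kL n),
      (edgesStmt.exec [] s 10 (x * Tableau.nodes ψ kL n + y) ≠ 0 ↔ Tableau.Edge ψ A x y) := by
  have hcap := h.cap
  have := Stmt.all_induction (e := []) (s := s)
    (p := .guard (lt (.var 0) (param 6)) (.set 10 (.var 0)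
      (edge (div (.var 0) (param 5)) (mod (.var 0) (param 5)))))
    (fun i s' => (∀ a, a ≠ 10 → s' a = s a) ∧ ∀ x y : Fin (Tableau.nodes ψ kL n),
      x * Tableau.nodes ψ kL n + y < i →
      (s' 10 (x * Tableau.nodes ψ kL n + y) ≠ 0 ↔ Tableau.Edge ψ A x y))
    ⟨fun _ _ => rfl, fun _ _ hj => by omega⟩ ?_
  · refine ⟨this.1, fun x y => this.2 x y ?_⟩
    have := Tableau.mul_add_lt x.2 y.2
    omega
  · rintro i - s' ⟨h1, h2⟩
    by_cases hi : i < Tableau.nodes ψ kL n * Tableau.nodes ψ kL n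
    · rw [exec_guard_pos ((h.isTrue_lt_pairs h1 i []).2 hi), exec_set (by omega) (by omega)]
      refine ⟨fun a ha => by rw [Store.set_of_ne _ ha, h1 a ha], fun x y hj => ?_⟩
      rw [Store.set_apply, eval_var_zero]
      by_cases hxy : x * Tableau.nodes ψ kL n + y = i
      · rw [if_pos ⟨rfl, hxy⟩]
        obtain ⟨e1, e2⟩ := h.eval_div_nodes h1 (e := []) hi
        have hpos : 0 < Tableau.nodes ψ kL n := x.pos
        have hx : i / Tableau.nodes ψ kL n = x := by
          rw [← hxy, mul_comm, Nat.mul_add_div hpos, Nat.div_eq_of_lt y.2, add_zero]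
        have hy : i % Tableau.nodes ψ kL n = y := by
          rw [← hxy, mul_comm, Nat.mul_add_mod, Nat.mod_eq_of_lt y.2]
        have := (h.congr h1).edge_iff (e := [i]) (x := div (.var 0) (param 5))
          (y := mod (.var 0) (param 5)) (by rw [e1, hx]; exact x.2) (by rw [e2, hy]; exact y.2)
        rw [IsTrue] at this
        rw [this]
        simp only [e1, e2, hx, hy]
      · rw [if_neg (by simp [hxy])]
        exact h2 x y (by omega)
    · rw [exec_guard_neg (by rw [h.isTrue_lt_pairs h1]; exact hi)]
      refine ⟨h1, fun x y hj => h2 x y ?_⟩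
      have := Tableau.mul_add_lt x.2 y.2
      omega

/-- The table is updated in place, so during round `k` an entry may already profit from new entries,
and exact equality with `pathsBelow E k` is not invariant. Instead two inclusions are maintained: a
nonzero entry always means reachability, and paths with inner nodes below `k` are always recorded.
They coincide once `k` reaches the number of nodes. -/
theorem exec_closureStmt (h : Ready ψ A s)
    {E : Fin (Tableau.nodes ψ kL n) → Fin (Tableau.nodes ψ kL n) → Prop}
    (hE : ∀ x y : Fin (Tableau.nodes ψ kL n),
      s 10 (x * Tableau.nodes ψ kL n + y) ≠ 0 ↔ E x y) :
    (∀ a, a ≠ 10 → closureStmt.exec [] s a = s a) ∧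
    ∀ x y : Fin (Tableau.nodes ψ kL n),
      (closureStmt.exec [] s 10 (x * Tableau.nodes ψ kL n + y) ≠ 0 ↔
        Relation.TransGen E x y) := by
  have hcap := h.cap
  have hN := h.nodes_le_cap
  have := Stmt.all_induction (e := []) (s := s)
    (p := .guard (lt (.var 0) (param 5)) (.all (.guard (lt (.var 0) (param 6)) (.set 10 (.var 0)
      ((Tm.read 10 (.var 0)).or ((reach (div (.var 0) (param 5)) (.var 1)).and
        (reach (.var 1) (mod (.var 0) (param 5)))))))))
    (fun k s' => (∀ a, a ≠ 10 → s' a = s a) ∧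
      (∀ x y : Fin (Tableau.nodes ψ kL n), s' 10 (x * Tableau.nodes ψ kL n + y) ≠ 0 →
        Relation.TransGen E x y) ∧
      ∀ x y : Fin (Tableau.nodes ψ kL n), pathsBelow E (min k (Tableau.nodes ψ kL n)) x y →
        s' 10 (x * Tableau.nodes ψ kL n + y) ≠ 0)
    ⟨fun _ _ => rfl, fun x y hxy => .single ((hE x y).1 hxy),
      fun x y hxy => (hE x y).2 (by simpa [pathsBelow] using hxy)⟩ ?_
  · refine ⟨this.1, fun x y => ⟨this.2.1 x y, fun hxy => this.2.2 x y ?_⟩⟩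
    rw [min_eq_right hN]
    exact pathsBelow_iff_transGen.2 hxy
  rintro k - s₁ ⟨h1, h2, h3⟩
  have h5 : IsTrue s₁ [k] (lt (.var 0) (param 5)) ↔ k < Tableau.nodes ψ kL n := by
    have h5 : (param 5).eval s₁ [k] = _ := (h.congr h1).nodes
    rw [isTrue_lt, h5]
    exact Iff.rfl
  by_cases hk : k < Tableau.nodes ψ kL n
  swap
  · rw [exec_guard_neg (by rw [h5]; exact hk)]
    refine ⟨h1, h2, ?_⟩
    rw [min_eq_right (by omega)] at h3 ⊢
    exact h3
  rw [exec_guard_pos (h5.2 hk)]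
  rw [min_eq_left hk.le] at h3
  have hcap₁ : s₁.cap = s.cap := by rw [(h.congr h1).cap, hcap]
  have := Stmt.all_induction (e := [k]) (s := s₁)
    (p := .guard (lt (.var 0) (param 6)) (.set 10 (.var 0)
      ((Tm.read 10 (.var 0)).or ((reach (div (.var 0) (param 5)) (.var 1)).and
        (reach (.var 1) (mod (.var 0) (param 5)))))))
    -- Within round `k`, completeness at level `k` is kept for all pairs, and level `k + 1` is
    -- reached for the pairs with index below `i`.
    (fun i s' => (∀ a, a ≠ 10 → s' a = s a) ∧
      (∀ x y : Fin (Tableau.nodes ψ kL n), s' 10 (x * Tableau.nodes ψ kL n + y) ≠ 0 →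
        Relation.TransGen E x y) ∧
      (∀ x y : Fin (Tableau.nodes ψ kL n), pathsBelow E k x y →
        s' 10 (x * Tableau.nodes ψ kL n + y) ≠ 0) ∧
      ∀ x y : Fin (Tableau.nodes ψ kL n), x * Tableau.nodes ψ kL n + y < i →
        pathsBelow E (k + 1) x y → s' 10 (x * Tableau.nodes ψ kL n + y) ≠ 0)
    ⟨h1, h2, h3, fun _ _ hj => by omega⟩ ?_
  · obtain ⟨g1, g2, -, g4⟩ := this
    refine ⟨g1, g2, fun x y => ?_⟩
    rw [min_eq_left (by omega)]
    refine g4 x y ?_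
    have := Tableau.mul_add_lt x.2 y.2
    omega
  rintro i - s₂ ⟨g1, g2, g3, g4⟩
  by_cases hi : i < Tableau.nodes ψ kL n * Tableau.nodes ψ kL n
  · rw [exec_guard_pos ((h.isTrue_lt_pairs g1 i [k]).2 hi), exec_set (by omega) (by omega)]
    have hR := h.congr g1
    obtain ⟨e1, e2⟩ := h.eval_div_nodes g1 (e := [k]) hi
    have hval : ∀ x y : Fin (Tableau.nodes ψ kL n), x * Tableau.nodes ψ kL n + y = i →
        (IsTrue s₂ [i, k] ((Tm.read 10 (.var 0)).or
          ((reach (div (.var 0) (param 5)) (.var 1)).and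
            (reach (.var 1) (mod (.var 0) (param 5))))) ↔
          s₂ 10 (x * Tableau.nodes ψ kL n + y) ≠ 0 ∨
          (s₂ 10 (x * Tableau.nodes ψ kL n + k) ≠ 0 ∧
            s₂ 10 (k * Tableau.nodes ψ kL n + y) ≠ 0)) := by
      intro x y hxy
      have hpos : 0 < Tableau.nodes ψ kL n := x.pos
      have hx : i / Tableau.nodes ψ kL n = x := by
        rw [← hxy, mul_comm, Nat.mul_add_div hpos, Nat.div_eq_of_lt y.2, add_zero]
      have hy : i % Tableau.nodes ψ kL n = y := by
        rw [← hxy, mul_comm, Nat.mul_add_mod, Nat.mod_eq_of_lt y.2]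
      have hr := fun x y : Tm => hR.reach_iff (e := [i, k]) (x := x) (y := y)
        (R := fun x y => s₂ 10 (x * Tableau.nodes ψ kL n + y) ≠ 0) (fun _ _ => Iff.rfl)
      rw [isTrue_or, isTrue_and, hr _ _ (by rw [e1, hx]; exact x.2) (by exact hk),
        hr _ _ (by exact hk) (by rw [e2, hy]; exact y.2)]
      simp only [e1, e2, hx, hy, IsTrue, eval_read_ten, eval_var_zero, hxy, eval_var_one]
    have hset : ∀ (x y : Fin (Tableau.nodes ψ kL n)) v,
        (s₂.set 10 i v) 10 (x * Tableau.nodes ψ kL n + y) =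
        if x * Tableau.nodes ψ kL n + y = i then v else s₂ 10 (x * Tableau.nodes ψ kL n + y) := by
      intro x y v
      rw [Store.set_apply]
      simp
    rw [eval_var_zero]
    refine ⟨fun a ha => by rw [Store.set_of_ne _ ha, g1 a ha], fun x y => ?_, fun x y hxy => ?_,
      fun x y hlt hxy => ?_⟩
    · rw [hset]
      split_ifs with he
      · intro hv
        rcases (hval x y he).1 hv with hv | ⟨hv, hv'⟩
        · exact g2 x y hv
        · exact (g2 x ⟨k, hk⟩ hv).trans (g2 ⟨k, hk⟩ y hv')
      · exact g2 x y
    · rw [hset]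
      split_ifs with he
      · exact (hval x y he).2 (Or.inl (g3 x y hxy))
      · exact g3 x y hxy
    · rw [hset]
      split_ifs with he
      · refine (hval x y he).2 ?_
        rcases hxy with hxy | ⟨_, hxy, hxy'⟩
        · exact Or.inl (g3 x y hxy)
        · exact Or.inr ⟨g3 _ _ hxy, g3 _ _ hxy'⟩
      · exact g4 x y (by omega) hxy
  · rw [exec_guard_neg (by rw [h.isTrue_lt_pairs g1]; exact hi)]
    refine ⟨g1, g2, g3, fun x y hj => g4 x y ?_⟩
    have := Tableau.mul_add_lt x.2 y.2
    omega

end Ready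

end BadPrefix

/-! ### The four phases and the running time -/

namespace BadPrefix

open RAM RAM.Tm

variable {m kT kL n : ℕ} {ψ : LTL m kT} {A : DFA (Fin kL → Letter m) (Fin n)}

/-- The sum of the parameters suffices as cap, since it dominates the base, the exponent and the
first factors occurring here. -/
theorem exec_widthPhase (ψ : LTL m kT) (A : DFA (Fin kL → Letter m) (Fin n)) :
    HasInput ψ A (widthPhase.exec (inputStore ψ A)) ∧
    widthPhase.exec (inputStore ψ A) 8 0 = m * kL ∧
    widthPhase.exec (inputStore ψ A) 8 1 = kL ^ kT ∧
    widthPhase.exec (inputStore ψ A) 8 3 = Tableau.width ψ kL ∧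
    (∀ j p, ψ.subs[j]? = some p → widthPhase.exec (inputStore ψ A) 9 j = p.size) ∧
    (widthPhase.start (inputStore ψ A)).cap = m + kL + kT + ψ.size + n := by
  have h0 : HasInput ψ A (inputStore ψ A) := fun _ _ => rfl
  set s := widthPhase.start (inputStore ψ A) with hs
  have hcap : s.cap = m + kL + kT + ψ.size + n := h0.eval_inputSum
  have h : HasInput ψ A s := h0.set (by omega) _ _
  set s₁ := s.set 8 0 (m * kL) with hs₁
  set s₂ := s₁.set 8 1 (kL ^ kT) with hs₂
  set s₃ := s₂.set 8 3 (Tableau.width ψ kL) with hs₃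
  have h₁ : HasInput ψ A s₁ := h.set (by omega) _ _
  have h₂ : HasInput ψ A s₂ := h₁.set (by omega) _ _
  have h₃ : HasInput ψ A s₃ := h₂.set (by omega) _ _
  have hcap₁ : s₁.cap = s.cap := cap_set (by omega) _ _ _
  have hcap₂ : s₂.cap = s.cap := (cap_set (by omega) _ _ _).trans hcap₁
  have hcap₃ : s₃.cap = s.cap := (cap_set (by omega) _ _ _).trans hcap₂
  have e₁ : (mul (input 0) (input 1)).eval s [] = m * kL := by
    rw [eval_mul (by rw [h.eval_input_zero]; omega), h.eval_input_zero, h.eval_input_one]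
  have e₂ : (pow (input 1) (input 2)).eval s₁ [] = kL ^ kT := by
    rw [eval_pow (by rw [h₁.eval_input_one]; omega) (by rw [h₁.eval_input_two]; omega),
      h₁.eval_input_one, h₁.eval_input_two]
  have e₃ : (Tm.plus (param 0) (mul (input 3) (param 1))).eval s₂ [] = Tableau.width ψ kL := by
    have p0 : (param 0).eval s₂ [] = m * kL := by
      change s₂ 8 0 = _
      simp [hs₂, hs₁, Store.set_apply]
    have p1 : (param 1).eval s₂ [] = kL ^ kT := by
      change s₂ 8 1 = _
      simp [hs₂]
    -- The order of the factors matters: `ψ.size` is at most the cap, whereas `kL ^ kT` may exceed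
    -- it.
    rw [eval_plus, eval_mul (by rw [h₂.eval_input_three]; omega), h₂.eval_input_three, p0, p1,
      mul_comm ψ.size, Tableau.width]
  have hexec : widthPhase.exec (inputStore ψ A) = sizesStmt.exec [] s₃ := by
    rw [Phase.exec, ← hs]
    simp only [widthPhase, Stmt.exec, Nat.reduceEqDiff, or_self, if_false, eval_const, e₁, ← hs₁,
      e₂, ← hs₂, e₃, ← hs₃]
  rw [hexec]
  obtain ⟨f1, f2⟩ := h₃.exec_sizesStmt (by omega)
  refine ⟨fun a ha => by rw [f1 a (by omega), h₃ a ha], ?_, ?_, ?_, f2, hcap⟩ <;>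
    rw [f1 8 (by omega)] <;> simp [hs₃, hs₂, hs₁, Store.set_apply]

/-- A cap linear in the width suffices to compute `2 ^ width`, because only base and exponent must
be below it; in the product with `n`, the small number `n` is the first factor. -/
theorem exec_nodesPhase {s : Store} (h : HasInput ψ A s) (hb : s 8 0 = m * kL)
    (hw : s 8 3 = Tableau.width ψ kL) :
    (∀ a, a ≠ 7 → a ≠ 8 → nodesPhase.exec s a = s a) ∧
    nodesPhase.exec s 8 0 = s 8 0 ∧ nodesPhase.exec s 8 1 = s 8 1 ∧
    nodesPhase.exec s 8 3 = s 8 3 ∧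
    nodesPhase.exec s 8 2 = 2 ^ (m * kL) ∧
    nodesPhase.exec s 8 4 = 2 ^ Tableau.width ψ kL ∧
    nodesPhase.exec s 8 5 = Tableau.nodes ψ kL n ∧
    (nodesPhase.start s).cap = Tableau.width ψ kL + n + 2 := by
  set s₀ := nodesPhase.start s with hs
  have hcap : s₀.cap = Tableau.width ψ kL + n + 2 := by
    change s 8 3 + (input 4).eval s [] + 2 = _
    rw [hw, h.eval_input_four]
  have h₀ : HasInput ψ A s₀ := h.set (by omega) _ _
  have hm : m * kL ≤ Tableau.width ψ kL := Nat.le_add_right _ _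
  have hs8 : s₀ 8 = s 8 := Store.set_of_ne _ (by omega) _ _
  set s₁ := s₀.set 8 2 (2 ^ (m * kL)) with hs₁
  set s₂ := s₁.set 8 4 (2 ^ Tableau.width ψ kL) with hs₂
  set s₃ := s₂.set 8 5 (Tableau.nodes ψ kL n) with hs₃
  have h₁ : HasInput ψ A s₁ := h₀.set (by omega) _ _
  have h₂ : HasInput ψ A s₂ := h₁.set (by omega) _ _
  have hcap₁ : s₁.cap = s₀.cap := cap_set (by omega) _ _ _
  have hcap₂ : s₂.cap = s₀.cap := (cap_set (by omega) _ _ _).trans hcap₁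
  have e₁ : (pow (.const 2) (param 0)).eval s₀ [] = 2 ^ (m * kL) := by
    have p0 : (param 0).eval s₀ [] = m * kL := by
      change s₀ 8 0 = _
      rw [hs8, hb]
    rw [eval_pow (by rw [eval_const]; omega) (by omega), p0, eval_const]
  have e₂ : (pow (.const 2) (param 3)).eval s₁ [] = 2 ^ Tableau.width ψ kL := by
    have p3 : (param 3).eval s₁ [] = Tableau.width ψ kL := by
      change s₁ 8 3 = _
      simp [hs₁, Store.set_apply, hs8, hw]
    rw [eval_pow (by rw [eval_const]; omega) (by omega), p3, eval_const]
  have e₃ : (mul (input 4) (param 4)).eval s₂ [] = Tableau.nodes ψ kL n := by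
    have p4 : (param 4).eval s₂ [] = 2 ^ Tableau.width ψ kL := by
      change s₂ 8 4 = _
      simp [hs₂]
    rw [eval_mul (by rw [h₂.eval_input_four]; omega), h₂.eval_input_four, p4, Tableau.nodes]
  have hexec : nodesPhase.exec s = s₃ := by
    rw [Phase.exec, ← hs]
    simp only [nodesPhase, Stmt.exec, Nat.reduceEqDiff, or_self, if_false, eval_const, e₁, ← hs₁,
      e₂, ← hs₂, e₃, ← hs₃]
  rw [hexec]
  refine ⟨fun a ha ha' => ?_, ?_, ?_, ?_, ?_, ?_, ?_, hcap⟩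
  · rw [hs₃, Store.set_of_ne _ ha', hs₂, Store.set_of_ne _ ha', hs₁, Store.set_of_ne _ ha', hs,
      Phase.start, Store.set_of_ne _ ha]
  all_goals simp [hs₃, hs₂, hs₁, Store.set_apply, hs8]

theorem exec_pairsPhase {s : Store} {V : ℕ} (h : s 8 5 = V) :
    (∀ a j, a ≠ 7 → (a = 8 → j ≠ 6) → pairsPhase.exec s a j = s a j) ∧
    pairsPhase.exec s 8 6 = V * V ∧ (pairsPhase.start s).cap = V := by
  have hcap : (pairsPhase.start s).cap = V := h
  have hs8 : pairsPhase.start s 8 = s 8 := Store.set_of_ne _ (by omega) _ _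
  have p5 : (param 5).eval (pairsPhase.start s) [] = V := by
    change pairsPhase.start s 8 5 = _
    rw [hs8, h]
  have hexec : pairsPhase.exec s = (pairsPhase.start s).set 8 6 (V * V) := by
    have : (mul (param 5) (param 5)).eval (pairsPhase.start s) [] = V * V := by
      rw [eval_mul (by omega), p5]
    rw [Phase.exec, ← this]
    rfl
  rw [hexec]
  refine ⟨fun a j ha ha' => ?_, by simp, hcap⟩
  rw [Store.set_apply, if_neg (by tauto), Phase.start, Store.set_of_ne _ ha]

/-- A bound for the number of iterations of each loop. -/
def bound (ψ : LTL m kT) (kL n : ℕ) : ℕ :=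
  Tableau.nodes ψ kL n * Tableau.nodes ψ kL n + Tableau.width ψ kL + kL ^ kT +
    (m + kL + kT + ψ.size + n) + 2

theorem exec_graphPhase {s : Store} (h : Ready ψ A (graphPhase.start s)) :
    (AcceptsOnlyBadPrefixes A (HyperLTL.univ ψ) → graphPhase.exec s 0 0 = 1) ∧
    (¬ AcceptsOnlyBadPrefixes A (HyperLTL.univ ψ) → graphPhase.exec s 0 0 = 0) := by
  obtain ⟨f1, f2⟩ := h.exec_edgesStmt
  obtain ⟨g1, g2⟩ := (h.congr f1).exec_closureStmt f2
  have hans := ((h.congr f1).congr g1).answer_iff g2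
  have hexec : graphPhase.exec s 0 0 = answer.not.eval (closureStmt.exec []
      (edgesStmt.exec [] (graphPhase.start s))) [] := by
    rw [Phase.exec, graphPhase, Stmt.exec, Stmt.exec, exec_set (by omega) (by omega)]
    exact Store.set_same _ _ _ _
  rw [hexec]
  constructor
  · intro hA
    rw [Tm.not, eval_ite_neg (by rwa [hans, not_not]), eval_const]
  · intro hA
    rw [Tm.not, eval_ite_pos (by rwa [hans]), eval_const]

/-- Each phase preserves the input and the numbers computed before, and its cap is at most the last
one, which is `bound`. So one bound serves all phases, and the last phase runs on a memory that is
`Ready`. -/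
theorem execList_phases (ψ : LTL m kT) (A : DFA (Fin kL → Letter m) (Fin n)) :
    Phase.BoundedBy (bound ψ kL n) phases (inputStore ψ A) ∧
    (AcceptsOnlyBadPrefixes A (HyperLTL.univ ψ) →
      Phase.execList phases (inputStore ψ A) 0 0 = 1) ∧
    (¬ AcceptsOnlyBadPrefixes A (HyperLTL.univ ψ) →
      Phase.execList phases (inputStore ψ A) 0 0 = 0) := by
  have hcap : ∀ (P : Phase) s, (P.exec s).cap = (P.start s).cap := fun P s => Stmt.cap_exec _ _ _
  obtain ⟨h1, b0, b1, b3, hsz, c1⟩ := exec_widthPhase ψ A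
  set s₁ := widthPhase.exec (inputStore ψ A) with hs₁
  obtain ⟨a2, d0, d1, d3, d2, d4, d5, c2⟩ := exec_nodesPhase h1 b0 b3
  set s₂ := nodesPhase.exec s₁ with hs₂
  have h2 : HasInput ψ A s₂ := fun a ha => by rw [a2 a (by omega) (by omega), h1 a ha]
  obtain ⟨a3, e6, c3⟩ := exec_pairsPhase d5
  set s₃ := pairsPhase.exec s₂ with hs₃
  have h3 : HasInput ψ A s₃ := fun a ha => by
    funext j
    rw [a3 a j (by omega) (by omega), h2 a ha]
  have e3 : s₃ 8 3 = Tableau.width ψ kL := by rw [a3 8 3 (by omega) (by omega), d3, b3]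
  have e1 : s₃ 8 1 = kL ^ kT := by rw [a3 8 1 (by omega) (by omega), d1, b1]
  have c4 : (graphPhase.start s₃).cap = bound ψ kL n := by
    change s₃ 8 6 + s₃ 8 3 + s₃ 8 1 + inputSum.eval s₃ [] + 2 = _
    rw [e6, e3, e1, h3.eval_inputSum, bound]
  have hs : ∀ a, a ≠ 7 → graphPhase.start s₃ a = s₃ a := fun a ha => Store.set_of_ne _ ha _ _
  have hR : Ready ψ A (graphPhase.start s₃) := by
    refine ⟨fun a ha => by rw [hs a (by omega), h3 a ha], ?_, ?_, ?_, ?_, ?_, ?_, ?_, ?_, c4⟩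
    · rw [hs 8 (by omega), a3 8 0 (by omega) (by omega), d0, b0]
    · rw [hs 8 (by omega), e1]
    · rw [hs 8 (by omega), a3 8 2 (by omega) (by omega), d2]
    · rw [hs 8 (by omega), e3]
    · rw [hs 8 (by omega), a3 8 4 (by omega) (by omega), d4]
    · rw [hs 8 (by omega), a3 8 5 (by omega) (by omega), d5]
    · rw [hs 8 (by omega), e6]
    · intro j p hj
      rw [hs 9 (by omega), a3 9 j (by omega) (by omega), a2 9 (by omega) (by omega), hsz j p hj]
  refine ⟨?_, exec_graphPhase hR⟩
  have hV := Nat.le_mul_self (Tableau.nodes ψ kL n)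
  have hb : bound ψ kL n = Tableau.nodes ψ kL n * Tableau.nodes ψ kL n + Tableau.width ψ kL +
    kL ^ kT + (m + kL + kT + ψ.size + n) + 2 := rfl
  -- In the input memory array `7` is zero, so the initial cap is `0`.
  refine ⟨Nat.zero_le _, ?_, ?_, ?_, ?_, ?_, ?_, ?_, trivial⟩
  · omega
  · rw [hcap]; omega
  · rw [← hs₁]; omega
  · rw [hcap, ← hs₁]; omega
  · rw [← hs₁, ← hs₂]; omega
  · rw [hcap, ← hs₁, ← hs₂]; omega
  · rw [← hs₁, ← hs₂, ← hs₃]; omega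

theorem exists_decidesWithin : ∃ c k, ∀ {m kT kL n : ℕ} (ψ : LTL m kT)
    (A : DFA (Fin kL → Letter m) (Fin n)), DecidesWithin (Phase.compileList phases)
      (inputStore ψ A) (AcceptsOnlyBadPrefixes A (HyperLTL.univ ψ))
      (c * (bound ψ kL n + 1) ^ k) := by
  obtain ⟨c, k, h⟩ := Phase.exists_runs_list phases
  refine ⟨c, k, fun ψ A => ?_⟩
  obtain ⟨hB, h1, h0⟩ := execList_phases ψ A
  obtain ⟨t, ht, s', hr, hs'⟩ := h _ _ _ (fun _ _ => rfl) hB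
  refine ⟨t, ht, s', hr, ?_, ?_⟩
  · rwa [hs' 0 (by omega)]
  · rwa [hs' 0 (by omega)]

theorem pow_le_two_pow_mul (a b : ℕ) : a ^ b ≤ 2 ^ (a * b) := by
  rw [pow_mul]
  exact Nat.pow_le_pow_left Nat.lt_two_pow_self.le b

/-- The squared number of nodes contributes `n ^ 2 * 2 ^ (2 * w)`; every other summand is absorbed
by `x < 2 ^ x` and `1 ≤ n ^ 2`. The resulting exponent is linear in `w`, `kL ^ kT` and the
parameters. As `|ψ| ≥ 1`, the factor `|ψ|` can be pulled out, and what remains is at most `4 * 2 ^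
Y`, which turns `m + 7` into `m + 9`. -/
theorem bound_succ_le (ψ : LTL m kT) (hn : 0 < n) {M : ℕ} (hT : kT ≤ M) (hL : kL ≤ M) :
    bound ψ kL n + 1 ≤ n ^ 2 * 2 ^ (ψ.size * 2 ^ (M ^ 2 + (2 * m + 2) * M + (m + 9))) := by
  have hN := ψ.size_pos
  set N := ψ.size with hNdef
  set w := Tableau.width ψ kL with hw
  set K := kL ^ kT with hK
  have hKle : K ≤ 2 ^ (M ^ 2) :=
    (pow_le_two_pow_mul _ _).trans (Nat.pow_le_pow_right (by omega)
      (by rw [sq]; exact Nat.mul_le_mul hL hT))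
  have hwle : w = m * kL + K * N := rfl
  have hmL : m * kL ≤ m * M := Nat.mul_le_mul_left _ hL
  have hsum : bound ψ kL n + 1 ≤ n ^ 2 * 2 ^ (2 * w + K + (m + kL + kT + N) + 5) := by
    have hx : ∀ x, x < 2 ^ x := fun x => Nat.lt_two_pow_self
    set y := w + K + (m + kL + kT + N) + 3 with hy
    have h1 : bound ψ kL n + 1 = n ^ 2 * 2 ^ (2 * w) + n + y := by
      simp only [bound, Tableau.nodes, ← hw, ← hK, ← hNdef, hy]
      rw [two_mul, pow_add]
      ring
    have hn2 : n ≤ n ^ 2 := Nat.le_self_pow (by omega) n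
    have h4 : 1 ≤ n ^ 2 := Nat.one_le_pow _ _ hn
    calc bound ψ kL n + 1 ≤ n ^ 2 * 2 ^ (2 * w) + n ^ 2 + n ^ 2 * y := by
          rw [h1]
          have : y ≤ n ^ 2 * y := Nat.le_mul_of_pos_left _ h4
          omega
      _ = n ^ 2 * (2 ^ (2 * w) + (y + 1)) := by ring
      _ ≤ n ^ 2 * (2 ^ (w + y) + 2 ^ (w + y)) := by
          refine Nat.mul_le_mul_left _ (Nat.add_le_add ?_ ?_)
          · exact Nat.pow_le_pow_right (by omega) (by omega)
          · exact (hx y).trans_le (Nat.pow_le_pow_right (by omega) (by omega))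
      _ = n ^ 2 * 2 ^ (w + y + 1) := by ring
      _ ≤ _ := Nat.mul_le_mul_left _ (Nat.pow_le_pow_right (by omega) (by omega))
  refine hsum.trans (Nat.mul_le_mul_left _ (Nat.pow_le_pow_right (by omega) ?_))
  set Y := M ^ 2 + (2 * m + 2) * M + (m + 7) with hY
  have hKY : K ≤ 2 ^ Y := hKle.trans (Nat.pow_le_pow_right (by omega) (by omega))
  have hYY : Y < 2 ^ Y := Nat.lt_two_pow_self
  have hr : (2 * m + 2) * M = 2 * (m * M) + 2 * M := by ring
  calc 2 * w + K + (m + kL + kT + N) + 5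
      ≤ N * (2 * (m * M) + 3 * K + m + 2 * M + 6) := by
        rw [hwle]
        nlinarith [Nat.zero_le (m * M), Nat.mul_le_mul_right (2 * (m * M) + K + m + 2 * M + 5) hN]
    _ ≤ N * (2 ^ Y + 3 * 2 ^ Y) := by
        refine Nat.mul_le_mul_left _ ?_
        omega
    _ = N * 2 ^ (Y + 2) := by ring
    _ = _ := by rw [hY, add_assoc _ (m + 7) 2]

end BadPrefix

theorem mainTheorem9 :
    ∃ prog : RAM.Prog, ∀ m : ℕ, ∃ P R : Polynomial ℕ,
      ∀ (kT kL n : ℕ) (ψ : LTL m kT) (A : DFA (Fin kL → Letter m) (Fin n)),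
        ψ.IsSafety →
        RAM.DecidesWithin prog (inputStore ψ A)
          (AcceptsOnlyBadPrefixes A (HyperLTL.univ ψ))
          (P.eval n * 2 ^ (ψ.size * 2 ^ (R.eval (max kT kL)))) := by
  obtain ⟨c, k, h⟩ := BadPrefix.exists_decidesWithin
  -- The running time is `c * (bound + 1) ^ k`. The `k`-th power turns `n ^ 2` into `n ^ (2 * k)`
  -- and multiplies the exponent of `2` by `k ≤ 2 ^ k`, whence the summand `k` in `R`.
  refine ⟨RAM.Phase.compileList BadPrefix.phases, fun m => ⟨.C c * .X ^ (2 * k),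
    .X ^ 2 + .C (2 * m + 2) * .X + .C (m + 9 + k), fun kT kL n ψ A _ => ?_⟩⟩
  obtain ⟨t, ht, hrun⟩ := h ψ A
  refine ⟨t, ht.trans ?_, hrun⟩
  -- The start state shows that there is at least one state.
  have hn : 0 < n := A.start.pos
  have hb := BadPrefix.bound_succ_le ψ hn (le_max_left kT kL) (le_max_right kT kL)
  simp only [Polynomial.eval_mul, Polynomial.eval_add, Polynomial.eval_pow, Polynomial.eval_X,
    Polynomial.eval_C]
  set M := max kT kL
  set Y := M ^ 2 + (2 * m + 2) * M + (m + 9) with hY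
  calc c * (BadPrefix.bound ψ kL n + 1) ^ k
      ≤ c * (n ^ 2 * 2 ^ (ψ.size * 2 ^ Y)) ^ k :=
        Nat.mul_le_mul_left _ (Nat.pow_le_pow_left hb k)
    _ = c * n ^ (2 * k) * 2 ^ (ψ.size * (2 ^ Y * k)) := by
        rw [mul_pow, ← pow_mul, ← pow_mul]
        ring_nf
    _ ≤ c * n ^ (2 * k) * 2 ^ (ψ.size * 2 ^ (Y + k)) := by
        rw [pow_add _ Y k]
        exact Nat.mul_le_mul_left _ (Nat.pow_le_pow_right (by omega)
          (Nat.mul_le_mul_left _ (Nat.mul_le_mul_left _ Nat.lt_two_pow_self.le)))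
    _ = _ := by rw [hY, add_assoc _ (m + 9)]
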